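/- Let $d\ge 2$ and let $\Omega\subset\mathbb R^d$ be a polytope with a conforming simplicial mesh $\mathcal T_h$, node set $\mathcal N_h$, and unit outward normal $\mathbf n_\Omega$. (The $(d-1)$-dimensional faces of the mesh are called edges.) Let the edges on $\partial\Omega$ be divided into those on $\Gamma_{\mathrm N}$ and those on $\Gamma_{\mathrm D}$. Let the following coefficients be constant on each element, respectively on each edge of $\Gamma_{\mathrm N}$: a symmetric positive definite matrix $\mathcal A$ and functions $c,\beta_1\ge 0$ on $\Omega$, and $\alpha,\beta_2\ge 0$ on $\Gamma_{\mathrm N}$, where $\beta_1>0$ on some element or $\beta_2>0$ on some edge of $\Gamma_{\mathrm N}$. Let $\gamma>0$. Let $c_0,\beta_{1,0},\alpha_0,\beta_{2,0}>0$ be thresholds that do not exceed the positive values of $c,\beta_1,\alpha,\beta_2$, respectively (for example, the smallest positive values), and put $$\Omega_+=\{x\in\Omega: c\ge c_0\text{ or }\beta_1\ge\beta_{1,0}\},\quad \Omega_0=\Omega\setminus\Omega_+,\quad \Gamma_{\mathrm N+}=\{x\in\Gamma_{\mathrm N}:\alpha\ge\alpha_0\text{ or }\beta_2\ge\beta_{2,0}\},\quad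 \Gamma_{\mathrm N0}=\Gamma_{\mathrm N}\setminus\Gamma_{\mathrm N+}.$$ Let $V=\{v\in H^1(\Omega): v=0\text{ on }\Gamma_{\mathrm D}\}$ and $V_h=\{v\in V: v|_K\in P_1(K)\ \forall K\in\mathcal T_h\}$. Let $(\Lambda,u_h)$, with $\Lambda\in\mathbb R$ and $u_h\in V_h\setminus\{0\}$, be a discrete eigenpair: $a(u_h,v)=(\Lambda+\gamma)\,b(u_h,v)$ for all $v\in V_h$, where $$a(u,v)=(\mathcal A\nabla u,\nabla v)+((c+\gamma\beta_1)u,v)+((\alpha+\gamma\beta_2)u,v)_{\Gamma_{\mathrm N}},\qquad b(u,v)=(\beta_1u,v)+(\beta_2u,v)_{\Gamma_{\mathrm N}}.$$ For $z\in\mathcal N_h$ let $\psi_z$ be the hat function of $z$ (continuous, affine on every element, $1$ at $z$ and $0$ at all other nodes), $\mathcal T_z$ the set of elements containing $z$, $\omega_z$ the interior of their union, and $\mathbf n_z$ its unit outward normal. Let $\Gamma^{\mathrm E}_z$ be the union of the edges on $\partial\omega_z$ that do not contain $z$, let $\Gamma^{\mathrm N+}_z$ and $\Gamma^{\mathrm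 N0}_z$ be the unions of the edges containing $z$ that lie on $\partial\omega_z\cap\Gamma_{\mathrm N+}$ and on $\partial\omega_z\cap\Gamma_{\mathrm N0}$, respectively, and let $\Gamma^{\mathrm N}_z=\Gamma^{\mathrm N+}_z\cup\Gamma^{\mathrm N0}_z$. Let $\mathrm{RT}_1(K)=[P_1(K)]^d+xP_1(K)$ and let $\Pi_E:L^2(E)\to P_1(E)$ be the $L^2$-orthogonal projection. Let $$W_z=\Big\{\sigma\in H(\mathrm{div},\omega_z):\ \sigma|_K\in\mathrm{RT}_1(K)\ \forall K\in\mathcal T_z,\ \ \sigma\cdot\mathbf n_z=0\text{ on }\Gamma^{\mathrm E}_z\cup\Gamma^{\mathrm N0}_z,\ \ \sigma\cdot\mathbf n_z=\tfrac{\Lambda\beta_2-\alpha}{\Lambda+\gamma}\Pi_E(\psi_zu_h)\text{ on edges }E\subset\Gamma^{\mathrm N+}_z\Big\},$$ let $W_z^0$ be the space of piecewise $\mathrm{RT}_1$ fields in $H(\mathrm{div},\omega_z)$ with $\sigma\cdot\mathbf n_z=0$ on $\Gamma^{\mathrm E}_z\cup\Gamma^{\mathrm N}_z$, and let $Q_z=\{\varphi\in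 L^2(\omega_z):\varphi|_K\in P_1(K)\ \forall K\in\mathcal T_z\}$. Suppose that for every $z\in\mathcal N_h$ the pair $(\sigma_z,q_z)\in W_z\times Q_z$ satisfies $$(\mathcal A^{-1}\sigma_z,w)_{\omega_z}+(q_z,\operatorname{div}w)_{\omega_z}=\Big(\psi_z\frac{\nabla u_h}{\Lambda+\gamma},w\Big)_{\omega_z}\quad\forall w\in W_z^0,$$ $$(\operatorname{div}\sigma_z,\varphi)_{\omega_z}=\Big(\frac{c-\Lambda\beta_1}{\Lambda+\gamma}\psi_zu_h,\varphi\Big)_{\omega_z}+\Big(\frac{(\mathcal A\nabla\psi_z)\cdot\nabla u_h}{\Lambda+\gamma},\varphi\Big)_{\omega_z}\quad\forall\varphi\in Q_z,$$ and let $\sigma_h=\sum_{z\in\mathcal N_h}\sigma_z$, each $\sigma_z$ being extended by zero to $\Omega$. Then: 1. $\sigma_h\in\widetilde W_h=\{\sigma\in H(\mathrm{div},\Omega):\sigma|_K\in\mathrm{RT}_1(K)\ \forall K\in\mathcal T_h,\ \sigma\cdot\mathbf n_\Omega=0\text{ on }\Gamma_{\mathrm N0}\}$; 2. $\operatorname{div}\sigma_h=\dfrac{c-\Lambda\beta_1}{\Lambda+\gamma}u_h$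 in $\Omega$ and $\sigma_h\cdot\mathbf n_\Omega=\dfrac{\Lambda\beta_2-\alpha}{\Lambda+\gamma}u_h$ on $\Gamma_{\mathrm N+}$; 3. consequently, the pair $(u_h,\sigma_h)$ satisfies the assumptions on the trial pairs in the Lehmann–Goerisch theorem: $u_h\in V$, $\sigma_h\in H(\mathrm{div},\Omega)$, $\beta_1u_h+\operatorname{div}\sigma_h=0$ in $\Omega_0$, and $\beta_2u_h-\sigma_h\cdot\mathbf n_\Omega=0$ on $\Gamma_{\mathrm N0}$. -/

import Mathlib

open MeasureTheory Filter Topology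
open scoped ContDiff

namespace FluxLocalization

/-- The Euclidean space `ℝ^d`. -/
abbrev Pt (d : ℕ) := EuclideanSpace ℝ (Fin d)

/-! ### Simplicial meshes -/

/-- A (conforming) simplicial mesh: a finite simplicial complex in `ℝ^d` in which every simplex is
a face of a `d`-dimensional one. A simplex is given by the finite set of its vertices. -/
structure SimplicialMesh (d : ℕ) where
  complex : Geometry.SimplicialComplex ℝ (Pt d)
  finite_faces : complex.faces.Finite
  pure_dim : ∀ s ∈ complex.faces, ∃ t ∈ complex.faces, s ⊆ t ∧ t.card = d + 1

/-- The closed simplex with vertex set `s`. -/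
abbrev simplex {d : ℕ} (s : Finset (Pt d)) : Set (Pt d) := convexHull ℝ (s : Set (Pt d))

namespace SimplicialMesh

variable {d : ℕ} (M : SimplicialMesh d)

/-- The elements `K ∈ 𝒯_h` (simplices of dimension `d`). -/
noncomputable def elements : Finset (Finset (Pt d)) :=
  M.finite_faces.toFinset.filter (fun s => s.card = d + 1)

/-- The edges of the mesh in dimension two, the facets in general (simplices of dimension
`d - 1`). -/
noncomputable def facets : Finset (Finset (Pt d)) :=
  M.finite_faces.toFinset.filter (fun s => s.card = d)

open scoped Classical in
/-- The nodes `𝒩_h`. -/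
noncomputable def nodes : Finset (Pt d) := M.elements.biUnion id

/-- The polytope `Ω` triangulated by the mesh. -/
def domain : Set (Pt d) := interior M.complex.space

open scoped Classical in
/-- The elements `𝒯_z` sharing the vertex `z`. -/
noncomputable def star (z : Pt d) : Finset (Finset (Pt d)) := M.elements.filter (fun K => z ∈ K)

/-- The patch `ω_z`: the interior of the union of the elements sharing the vertex `z`. -/
def patch (z : Pt d) : Set (Pt d) := interior (⋃ K ∈ M.star z, simplex K)

open scoped Classical in
/-- The facets of the mesh that lie on the boundary of `D`. -/
noncomputable def boundaryFacets (D : Set (Pt d)) : Finset (Finset (Pt d)) :=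
  M.facets.filter (fun E => simplex E ⊆ frontier D)

/-- `t` is the barycentric coordinate of the point `x` belonging to the node `z` in an element of
the mesh that contains `x` (it is `0` if `z` is not a vertex of that element). -/
def IsBarycentric (z x : Pt d) (t : ℝ) : Prop :=
  ∃ K ∈ M.elements, ∃ w : Pt d → ℝ, (∀ y, 0 ≤ w y) ∧ (∀ y, y ∉ K → w y = 0) ∧
    ∑ y ∈ K, w y = 1 ∧ ∑ y ∈ K, w y • y = x ∧ w z = t

/-- The hat function `ψ_z`: affine on every element, `1` at `z` and `0` at all other nodes. At a
point of `closure Ω` the set below has exactly one element, the barycentric coordinate with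
respect to `z`. -/
noncomputable def hat (z x : Pt d) : ℝ := sSup {t | M.IsBarycentric z x t}

open scoped Classical in
/-- The function that equals the constant `a K` in the interior of each element `K`. -/
noncomputable def piecewise {R : Type*} [AddCommMonoid R] (a : Finset (Pt d) → R) (x : Pt d) : R :=
  ∑ K ∈ M.elements, if x ∈ interior (simplex K) then a K else 0

end SimplicialMesh

/-! ### Function spaces -/

/-- `P₁(K)`, almost everywhere on the element. -/
def IsP1On {d : ℕ} (K : Finset (Pt d)) (f : Pt d → ℝ) : Prop :=
  ∃ p : Pt d →ᵃ[ℝ] ℝ, ∀ᵐ x ∂(volume.restrict (simplex K)), f x = p x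

/-- The first-order Raviart--Thomas space `RT₁(K) = [P₁(K)]^d + x P₁(K)`, almost everywhere on the
element. -/
def IsRT1On {d : ℕ} (K : Finset (Pt d)) (σ : Pt d → Pt d) : Prop :=
  ∃ (a : Pt d →ᵃ[ℝ] Pt d) (p : Pt d →ᵃ[ℝ] ℝ),
    ∀ᵐ x ∂(volume.restrict (simplex K)), σ x = a x + p x • x

/-- Smooth test functions with compact support in `D`. -/
def IsTestFunction {d : ℕ} (D : Set (Pt d)) (φ : Pt d → ℝ) : Prop :=
  ContDiff ℝ ∞ φ ∧ HasCompactSupport φ ∧ tsupport φ ⊆ D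

/-- `f` is the weak divergence of `σ` in the open set `D`. -/
def HasWeakDiv {d : ℕ} (D : Set (Pt d)) (σ : Pt d → Pt d) (f : Pt d → ℝ) : Prop :=
  ∀ φ : Pt d → ℝ, IsTestFunction D φ →
    ∫ x in D, inner ℝ (σ x) (gradient φ x) = -∫ x in D, f x * φ x

/-- `G` is the weak gradient of `v` in the open set `D`. -/
def HasWeakGradient {d : ℕ} (D : Set (Pt d)) (v : Pt d → ℝ) (G : Pt d → Pt d) : Prop :=
  ∀ φ : Pt d → ℝ, IsTestFunction D φ →
    ∫ x in D, v x • gradient φ x = -∫ x in D, φ x • G x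

/-- `σ ∈ H(div, D)` with `div σ = f`. -/
structure MemHdiv {d : ℕ} (D : Set (Pt d)) (σ : Pt d → Pt d) (f : Pt d → ℝ) : Prop where
  memLp : MemLp σ 2 (volume.restrict D)
  memLp_div : MemLp f 2 (volume.restrict D)
  hasWeakDiv : HasWeakDiv D σ f

/-- The surface integral over a facet. -/
noncomputable def facetIntegral {d : ℕ} (E : Finset (Pt d)) (g : Pt d → ℝ) : ℝ :=
  ∫ x in simplex E, g x ∂(μHE[d - 1])

/-- The normal trace of a field `σ ∈ H(div, D)` with `div σ = f` on a part of the boundary: for a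
set `F` of facets on `∂D`, it says that `σ · n = g E` on every `E ∈ F`, where `n` is the unit
outward normal to `∂D`. As usual in `H(div, D)`, this is understood through Green's formula
`(σ, ∇v)_D + (div σ, v)_D = ⟨σ · n, v⟩_{∂D}`, tested by the smooth functions `v` that vanish on the
rest of the boundary. -/
def HasNormalTrace {d : ℕ} (M : SimplicialMesh d) (D : Set (Pt d)) (σ : Pt d → Pt d)
    (f : Pt d → ℝ) (F : Finset (Finset (Pt d))) (g : Finset (Pt d) → Pt d → ℝ) : Prop :=
  ∀ v : Pt d → ℝ, ContDiff ℝ ∞ v →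
    (∀ E ∈ M.boundaryFacets D, E ∉ F → ∀ x ∈ simplex E, v x = 0) →
    (∫ x in D, inner ℝ (σ x) (gradient v x)) + ∫ x in D, f x * v x
      = ∑ E ∈ F, facetIntegral E (fun x => g E x * v x)

/-- `p = Π_E f`, where `Π_E : L²(E) → P₁(E)` is the `L²(E)`-orthogonal projection. -/
def IsFacetProjection {d : ℕ} (E : Finset (Pt d)) (f : Pt d → ℝ) (p : Pt d →ᵃ[ℝ] ℝ) : Prop :=
  ∀ q : Pt d →ᵃ[ℝ] ℝ, facetIntegral E (fun x => (f x - p x) * q x) = 0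

/-! ### The eigenvalue problem and its finite element discretization -/

/-- The data of the eigenvalue problem
`-div(𝒜∇u) + c u = λ β₁ u` in `Ω`, `(𝒜∇u)·n + α u = λ β₂ u` on `Γ_N`, `u = 0` on `Γ_D`,
with coefficients that are piecewise constant on a mesh of `Ω`, with the shift parameter `γ`,
and with the threshold values `c₀`, `β₁₀`, `α₀`, `β₂₀`. -/
structure EigenProblem (d : ℕ) where
  mesh : SimplicialMesh d
  /-- the facets on `Γ_N`; all the other facets on `∂Ω` lie on `Γ_D` -/
  neumann : Finset (Finset (Pt d))
  neumann_subset : neumann ⊆ mesh.boundaryFacets mesh.domain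
  A : Finset (Pt d) → Matrix (Fin d) (Fin d) ℝ
  A_posDef : ∀ K ∈ mesh.elements, (A K).PosDef
  c : Finset (Pt d) → ℝ
  c_nonneg : ∀ K ∈ mesh.elements, 0 ≤ c K
  β₁ : Finset (Pt d) → ℝ
  β₁_nonneg : ∀ K ∈ mesh.elements, 0 ≤ β₁ K
  α : Finset (Pt d) → ℝ
  α_nonneg : ∀ E ∈ neumann, 0 ≤ α E
  β₂ : Finset (Pt d) → ℝ
  β₂_nonneg : ∀ E ∈ neumann, 0 ≤ β₂ E
  nondegenerate : (∃ K ∈ mesh.elements, 0 < β₁ K) ∨ ∃ E ∈ neumann, 0 < β₂ E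
  γ : ℝ
  γ_pos : 0 < γ
  /-- The thresholds are positive and do not exceed the positive values of the coefficients; the
  natural choice is the smallest positive value. -/
  c₀ : ℝ
  c₀_pos : 0 < c₀
  c₀_le : ∀ K ∈ mesh.elements, 0 < c K → c₀ ≤ c K
  β₁₀ : ℝ
  β₁₀_pos : 0 < β₁₀
  β₁₀_le : ∀ K ∈ mesh.elements, 0 < β₁ K → β₁₀ ≤ β₁ K
  α₀ : ℝ
  α₀_pos : 0 < α₀
  α₀_le : ∀ E ∈ neumann, 0 < α E → α₀ ≤ α E
  β₂₀ : ℝ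
  β₂₀_pos : 0 < β₂₀
  β₂₀_le : ∀ E ∈ neumann, 0 < β₂ E → β₂₀ ≤ β₂ E

namespace EigenProblem

variable {d : ℕ} (P : EigenProblem d)

/-- The domain `Ω`. -/
def Ω : Set (Pt d) := P.mesh.domain

/-- The coefficient `c` as a function on `Ω`. -/
noncomputable def cFun : Pt d → ℝ := P.mesh.piecewise P.c

/-- The coefficient `β₁` as a function on `Ω`. -/
noncomputable def β₁Fun : Pt d → ℝ := P.mesh.piecewise P.β₁

/-- The field `𝒜 w`. -/
noncomputable def applyA (w : Pt d → Pt d) (x : Pt d) : Pt d :=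
  Matrix.toEuclideanLin (P.mesh.piecewise P.A x) (w x)

/-- The field `𝒜⁻¹ w`. -/
noncomputable def applyAInv (w : Pt d → Pt d) (x : Pt d) : Pt d :=
  Matrix.toEuclideanLin (P.mesh.piecewise (fun K => (P.A K)⁻¹) x) (w x)

open scoped Classical in
/-- The facets on `Γ_D`. -/
noncomputable def dirichlet : Finset (Finset (Pt d)) := P.mesh.boundaryFacets P.Ω \ P.neumann

/-- The set `Ω₊`. -/
def ΩPlus : Set (Pt d) := {x ∈ P.Ω | P.c₀ ≤ P.cFun x ∨ P.β₁₀ ≤ P.β₁Fun x}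

/-- The set `Ω₀ = Ω \ Ω₊`. -/
def ΩZero : Set (Pt d) := P.Ω \ P.ΩPlus

open scoped Classical in
/-- The facets on `Γ_{N+}`. -/
noncomputable def neumannPlus : Finset (Finset (Pt d)) :=
  P.neumann.filter (fun E => P.α₀ ≤ P.α E ∨ P.β₂₀ ≤ P.β₂ E)

open scoped Classical in
/-- The facets on `Γ_{N0}`. -/
noncomputable def neumannZero : Finset (Finset (Pt d)) := P.neumann \ P.neumannPlus

/-- The space `V = {v ∈ H¹(Ω) : v = 0 on Γ_D}`. The trace of `v ∈ H¹(Ω)` is the limit in `L²` of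
the restrictions to the boundary of smooth functions that converge to `v` in `H¹(Ω)`. -/
def MemV (v : Pt d → ℝ) : Prop :=
  MemLp v 2 (volume.restrict P.Ω) ∧
  ∃ G : Pt d → Pt d, MemLp G 2 (volume.restrict P.Ω) ∧ HasWeakGradient P.Ω v G ∧
    ∃ φ : ℕ → Pt d → ℝ, (∀ k, ContDiff ℝ ∞ (φ k)) ∧
      Tendsto (fun k => eLpNorm (fun x => φ k x - v x) 2 (volume.restrict P.Ω)) atTop (𝓝 0) ∧
      Tendsto (fun k => eLpNorm (fun x => gradient (φ k) x - G x) 2 (volume.restrict P.Ω))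
        atTop (𝓝 0) ∧
      ∀ E ∈ P.dirichlet,
        Tendsto (fun k => eLpNorm (φ k) 2 ((μHE[d - 1]).restrict (simplex E))) atTop (𝓝 0)

/-- The finite element space `V_h = {v ∈ V : v|_K ∈ P₁(K) for all K ∈ 𝒯_h}`. The elements `K` are
closed, so `v` is the representative that is continuous on `closure Ω`; its boundary values are its
trace, and its pointwise gradient in the interior of the elements is its weak gradient. -/
def MemVh (v : Pt d → ℝ) : Prop :=
  P.MemV v ∧ ∀ K ∈ P.mesh.elements, ∃ p : Pt d →ᵃ[ℝ] ℝ, ∀ x ∈ simplex K, v x = p x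

/-- The bilinear form `a(u, v)`, for functions of `V_h`. -/
noncomputable def a (u v : Pt d → ℝ) : ℝ :=
  (∫ x in P.Ω, inner ℝ (P.applyA (gradient u) x) (gradient v x)) +
    (∫ x in P.Ω, (P.cFun x + P.γ * P.β₁Fun x) * u x * v x) +
    ∑ E ∈ P.neumann, facetIntegral E (fun x => (P.α E + P.γ * P.β₂ E) * u x * v x)

/-- The bilinear form `b(u, v)`, for functions of `V_h`. -/
noncomputable def b (u v : Pt d → ℝ) : ℝ :=
  (∫ x in P.Ω, P.β₁Fun x * u x * v x) +
    ∑ E ∈ P.neumann, facetIntegral E (fun x => P.β₂ E * u x * v x)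

/-- `(Λ, u)` is a finite element eigenpair: `u ∈ V_h \ {0}` and
`a(u, v) = (Λ + γ) b(u, v)` for all `v ∈ V_h`. -/
structure IsDiscreteEigenpair (Λ : ℝ) (u : Pt d → ℝ) : Prop where
  memVh : P.MemVh u
  ne_zero : ∃ x ∈ P.Ω, u x ≠ 0
  eq : ∀ v, P.MemVh v → P.a u v = (Λ + P.γ) * P.b u v

/-! ### The local problems on patches -/

/-- `Γ^E_z`: the facets on `∂ω_z` that do not contain `z`. -/
noncomputable def outerFacets (z : Pt d) : Finset (Finset (Pt d)) :=
  open scoped Classical in (P.mesh.boundaryFacets (P.mesh.patch z)).filter (fun E => z ∉ E)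

/-- `Γ^{N+}_z`: the facets on `Γ_{N+} ∩ ∂ω_z` that contain `z`. -/
noncomputable def localNeumannPlus (z : Pt d) : Finset (Finset (Pt d)) :=
  open scoped Classical in
  P.neumannPlus.filter (fun E => E ∈ P.mesh.boundaryFacets (P.mesh.patch z) ∧ z ∈ E)

/-- `Γ^{N0}_z`: the facets on `Γ_{N0} ∩ ∂ω_z` that contain `z`. -/
noncomputable def localNeumannZero (z : Pt d) : Finset (Finset (Pt d)) :=
  open scoped Classical in
  P.neumannZero.filter (fun E => E ∈ P.mesh.boundaryFacets (P.mesh.patch z) ∧ z ∈ E)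

/-- `Γ^E_z ∪ Γ^{N0}_z ∪ Γ^{N+}_z`: the facets where normal fluxes are prescribed. -/
noncomputable def prescribedFacets (z : Pt d) : Finset (Finset (Pt d)) :=
  open scoped Classical in P.outerFacets z ∪ P.localNeumannZero z ∪ P.localNeumannPlus z

/-- `w` belongs to the space `W⁰_z` and `div w = f`. -/
structure MemWzZero (z : Pt d) (w : Pt d → Pt d) (f : Pt d → ℝ) : Prop where
  memHdiv : MemHdiv (P.mesh.patch z) w f
  isRT1 : ∀ K ∈ P.mesh.star z, IsRT1On K w
  normalTrace : HasNormalTrace P.mesh (P.mesh.patch z) w f (P.prescribedFacets z) (fun _ _ => 0)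

open scoped Classical in
/-- `σ` belongs to the space `W_z` and `div σ = f`: the normal component of `σ` is
`(Λ β₂ - α) / (Λ + γ) Π_E(ψ_z u)` on the facets `E` of `Γ^{N+}_z`, and zero on `Γ^E_z ∪ Γ^{N0}_z`. -/
structure MemWz (Λ : ℝ) (u : Pt d → ℝ) (z : Pt d) (σ : Pt d → Pt d) (f : Pt d → ℝ) : Prop where
  memHdiv : MemHdiv (P.mesh.patch z) σ f
  isRT1 : ∀ K ∈ P.mesh.star z, IsRT1On K σ
  normalTrace : ∃ p : Finset (Pt d) → Pt d →ᵃ[ℝ] ℝ,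
    (∀ E ∈ P.localNeumannPlus z, IsFacetProjection E (fun x => P.mesh.hat z x * u x) (p E)) ∧
    HasNormalTrace P.mesh (P.mesh.patch z) σ f (P.prescribedFacets z)
      (fun E x => if E ∈ P.localNeumannPlus z
        then (Λ * P.β₂ E - P.α E) / (Λ + P.γ) * p E x else 0)

/-- The space `Q_z` of piecewise affine functions on the patch. -/
structure MemQz (z : Pt d) (φ : Pt d → ℝ) : Prop where
  memLp : MemLp φ 2 (volume.restrict (P.mesh.patch z))
  isP1 : ∀ K ∈ P.mesh.star z, IsP1On K φ

/-- `(σ, q) ∈ W_z × Q_z` solves the local saddle point problem on the patch `ω_z`. -/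
def IsLocalSolution (Λ : ℝ) (u : Pt d → ℝ) (z : Pt d) (σ : Pt d → Pt d) (q : Pt d → ℝ) : Prop :=
  ∃ f : Pt d → ℝ, P.MemWz Λ u z σ f ∧ P.MemQz z q ∧
    (∀ (w : Pt d → Pt d) (g : Pt d → ℝ), P.MemWzZero z w g →
      (∫ x in P.mesh.patch z, inner ℝ (P.applyAInv σ x) (w x)) +
          ∫ x in P.mesh.patch z, q x * g x
        = ∫ x in P.mesh.patch z,
            inner ℝ ((P.mesh.hat z x / (Λ + P.γ)) • gradient u x) (w x)) ∧
    (∀ φ : Pt d → ℝ, P.MemQz z φ →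
      ∫ x in P.mesh.patch z, f x * φ x
        = (∫ x in P.mesh.patch z,
            (P.cFun x - Λ * P.β₁Fun x) / (Λ + P.γ) * (P.mesh.hat z x * u x) * φ x) +
          ∫ x in P.mesh.patch z,
            inner ℝ (P.applyA (gradient (P.mesh.hat z)) x) (gradient u x) / (Λ + P.γ) * φ x)

open scoped Classical in
/-- The flux `∑_z σ_z`, where each `σ_z` is extended by zero outside the patch `ω_z`. -/
noncomputable def sumFlux (σ : Pt d → Pt d → Pt d) (x : Pt d) : Pt d :=
  ∑ z ∈ P.mesh.nodes, if x ∈ P.mesh.patch z then σ z x else 0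

/-! ### The global space, the constraints, and the assumptions of the Lehmann--Goerisch method -/

/-- The space `W̃_h` of piecewise `RT₁` fields in `H(div, Ω)` with `σ · n = 0` on `Γ_{N0}`. -/
def MemWTilde (σ : Pt d → Pt d) : Prop :=
  ∃ f : Pt d → ℝ, MemHdiv P.Ω σ f ∧ (∀ K ∈ P.mesh.elements, IsRT1On K σ) ∧
    HasNormalTrace P.mesh P.Ω σ f P.neumannZero (fun _ _ => 0)

/-- The constraints `div σ = (c - Λ β₁) / (Λ + γ) u` in `Ω` and
`σ · n = (Λ β₂ - α) / (Λ + γ) u` on `Γ_{N+}`. -/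
def SatisfiesConstraints (Λ : ℝ) (u : Pt d → ℝ) (σ : Pt d → Pt d) : Prop :=
  ∃ f : Pt d → ℝ, MemHdiv P.Ω σ f ∧
    (∀ᵐ x ∂(volume.restrict P.Ω), f x = (P.cFun x - Λ * P.β₁Fun x) / (Λ + P.γ) * u x) ∧
    HasNormalTrace P.mesh P.Ω σ f P.neumannPlus
      (fun E x => (Λ * P.β₂ E - P.α E) / (Λ + P.γ) * u x)

/-- The assumptions of the Lehmann--Goerisch method on a pair `(u, σ)`: `u ∈ V` and
`σ ∈ H(div, Ω)` with `β₁ u + div σ = 0` in `Ω₀` and `β₂ u - σ · n = 0` on `Γ_{N0}`. Here `u` is a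
function given up to the boundary, whose boundary values are its trace. -/
def LehmannGoerischAdmissible (u : Pt d → ℝ) (σ : Pt d → Pt d) : Prop :=
  P.MemV u ∧ ∃ f : Pt d → ℝ, MemHdiv P.Ω σ f ∧
    (∀ᵐ x ∂(volume.restrict P.ΩZero), P.β₁Fun x * u x + f x = 0) ∧
    HasNormalTrace P.mesh P.Ω σ f P.neumannZero (fun E x => P.β₂ E * u x)

end EigenProblem

end FluxLocalization

namespace FluxLocalization

variable {d : ℕ}

/-! The local problems are designed so that their sum over the nodes reproduces the global
conditions, because the hat functions form a partition of unity: on each element `∑ ψ_z = 1`, hence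
`∑ ∇ψ_z = 0`.

Divergence. The divergence of an `RT₁` field is affine on each element (`IsRT1On.isP1On_div`), so
the discontinuous space `Q_z` suffices to identify it. When the divergence equations of the vertices
of `K` are added, the terms with `𝒜∇ψ_z` cancel and `(c - Λβ₁)/(Λ + γ) u` remains (`sum_div_ae_eq`).

Normal components. Every local Green formula is tested with the same smooth `v`, which vanishes on
`Γ_D`. Its boundary term comes from the facets of `Γ_{N+}` containing `z` only: the flux is zero on
`Γ^E_z` and `Γ^{N0}_z`, and the facets of `∂ω_z` without prescribed flux lie on `Γ_D`
(`mem_boundaryFacets_of_notMem_prescribedFacets`). No interior jumps have to be examined. On a facet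
of `Γ_{N+}` the projections `Π_E(ψ_z u)` add up to `Π_E u = u` (`sum_facetProjection_ae_eq`), which
gives the global Green formula `integral_sumFlux_gradient`. Three classes of `v` turn it into
membership in `H(div, Ω)`, the trace on `Γ_{N0}` and the trace on `Γ_{N+}`.

The Lehmann–Goerisch conditions follow, since the thresholds force `c = β₁ = 0` a.e. on `Ω₀` and `β₂
= 0` on `Γ_{N0}`. -/

theorem isCompact_simplex (s : Finset (Pt d)) : IsCompact (simplex s) :=
  s.finite_toSet.isCompact_convexHull ℝ

theorem measurableSet_simplex (s : Finset (Pt d)) : MeasurableSet (simplex s) :=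
  (isCompact_simplex s).measurableSet

/-! ### Barycentric coordinates and hat functions. -/

namespace SimplicialMesh

variable (M : SimplicialMesh d)

theorem mem_elements {K : Finset (Pt d)} :
    K ∈ M.elements ↔ K ∈ M.complex.faces ∧ K.card = d + 1 := by
  simp [elements]

theorem mem_facets {E : Finset (Pt d)} :
    E ∈ M.facets ↔ E ∈ M.complex.faces ∧ E.card = d := by
  simp [facets]

theorem mem_boundaryFacets {D : Set (Pt d)} {E : Finset (Pt d)} :
    E ∈ M.boundaryFacets D ↔ E ∈ M.facets ∧ simplex E ⊆ frontier D := by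
  simp [boundaryFacets]

theorem mem_star {z : Pt d} {K : Finset (Pt d)} :
    K ∈ M.star z ↔ K ∈ M.elements ∧ z ∈ K := by
  simp [star]

theorem mem_nodes {z : Pt d} : z ∈ M.nodes ↔ ∃ K ∈ M.elements, z ∈ K := by
  simp [nodes]

variable {M}

theorem exists_element_of_mem_faces {s : Finset (Pt d)} (hs : s ∈ M.complex.faces) :
    ∃ K ∈ M.elements, s ⊆ K := by
  obtain ⟨K, hK, hsK, hc⟩ := M.pure_dim s hs
  exact ⟨K, M.mem_elements.2 ⟨hK, hc⟩, hsK⟩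

theorem exists_element_of_mem_facets {E : Finset (Pt d)} (hE : E ∈ M.facets) :
    ∃ K ∈ M.elements, E ⊆ K :=
  exists_element_of_mem_faces (M.mem_facets.1 hE).1

/-- The vertices are affinely independent, and the differences of the weights form an affine
relation between them. -/
theorem eq_zero_off_of_sum_eq {K : Finset (Pt d)} (hK : K ∈ M.elements) {w w' : Pt d → ℝ}
    (h1 : ∑ y ∈ K, w y = ∑ y ∈ K, w' y) (h2 : ∑ y ∈ K, w y • y = ∑ y ∈ K, w' y • y) :
    ∀ y ∈ K, w y = w' y := by
  intro y hy
  have := (M.complex.indep (M.mem_elements.1 hK).1).eq_zero_of_sum_eq_zero_subtype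
    (w := fun y => w y - w' y) (by simp [h1]) (by simp [sub_smul, h2]) y hy
  linarith

/-- A point in two elements has the same barycentric coordinates in both. -/
theorem IsBarycentric.unique {z x : Pt d} {t t' : ℝ} (h : M.IsBarycentric z x t)
    (h' : M.IsBarycentric z x t') : t = t' := by
  classical
  obtain ⟨K, hK, w, w0, wK, w1, wx, rfl⟩ := h
  obtain ⟨K', hK', w', w0', wK', w1', wx', rfl⟩ := h'
  have hx : x ∈ convexHull ℝ (K : Set (Pt d)) :=
    Finset.mem_convexHull'.2 ⟨w, fun y _ => w0 y, w1, wx⟩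
  have hx' : x ∈ convexHull ℝ (K' : Set (Pt d)) :=
    Finset.mem_convexHull'.2 ⟨w', fun y _ => w0' y, w1', wx'⟩
  -- Conformity of the mesh: `x` lies in the hull of the common vertices. Its weights there,
  -- extended by zero to `V`, must coincide with `w` on `K` and with `w'` on `K'`.
  have hi := M.complex.inter_subset_convexHull (M.mem_elements.1 hK).1
    (M.mem_elements.1 hK').1 ⟨hx, hx'⟩
  rw [← Finset.coe_inter, Finset.mem_convexHull'] at hi
  obtain ⟨v, -, v1, vx⟩ := hi
  set V : Pt d → ℝ := fun y => if y ∈ K ∩ K' then v y else 0 with hV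
  have key : ∀ L : Finset (Pt d), K ∩ K' ⊆ L → ∑ y ∈ L, V y = 1 ∧ ∑ y ∈ L, V y • y = x := by
    intro L hL
    constructor
    · rw [← v1, ← Finset.sum_subset hL]
      · exact Finset.sum_congr rfl fun y hy => by simp only [hV, hy, if_true]
      · intro y _ hy; simp only [hV, hy, if_false]
    · rw [← vx, ← Finset.sum_subset hL]
      · exact Finset.sum_congr rfl fun y hy => by simp only [hV, hy, if_true]
      · intro y _ hy; simp only [hV, hy, if_false, zero_smul]
  have e1 := eq_zero_off_of_sum_eq hK (w := w) (w' := V)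
    (w1.trans (key K Finset.inter_subset_left).1.symm)
    (wx.trans (key K Finset.inter_subset_left).2.symm)
  have e2 := eq_zero_off_of_sum_eq hK' (w := w') (w' := V)
    (w1'.trans (key K' Finset.inter_subset_right).1.symm)
    (wx'.trans (key K' Finset.inter_subset_right).2.symm)
  have f1 : w z = V z := by
    by_cases hz : z ∈ K
    · exact e1 z hz
    · simp [hV, hz, wK z hz]
  have f2 : w' z = V z := by
    by_cases hz : z ∈ K'
    · exact e2 z hz
    · simp [hV, hz, wK' z hz]
  rw [f1, f2]

theorem IsBarycentric.hat_eq {z x : Pt d} {t : ℝ} (h : M.IsBarycentric z x t) :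
    M.hat z x = t := by
  have : {t | M.IsBarycentric z x t} = {t} := by
    ext s; exact ⟨fun hs => IsBarycentric.unique hs h, fun hs => by rw [hs]; exact h⟩
  rw [hat, this, csSup_singleton]

/-- On a face, the values of the hat functions are the barycentric coordinates. -/
theorem exists_weights_eq_hat {s K : Finset (Pt d)} (hK : K ∈ M.elements) (hs : s ⊆ K) {x : Pt d}
    (hx : x ∈ simplex s) :
    (∀ z, 0 ≤ M.hat z x) ∧ (∀ z, z ∉ s → M.hat z x = 0) ∧ ∑ z ∈ s, M.hat z x = 1 ∧
      ∑ z ∈ s, M.hat z x • z = x := by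
  classical
  obtain ⟨v, v0, v1, vx⟩ := Finset.mem_convexHull'.1 hx
  set V : Pt d → ℝ := fun y => if y ∈ s then v y else 0 with hV
  have V0 : ∀ y, 0 ≤ V y := by
    intro y
    by_cases hy : y ∈ s
    · simpa only [hV, hy, if_true] using v0 y hy
    · simp only [hV, hy, if_false, le_refl]
  have Vs : ∀ y, y ∉ s → V y = 0 := fun y hy => by simp only [hV, hy, if_false]
  have s1 : ∑ y ∈ s, V y = 1 := by
    rw [← v1]; exact Finset.sum_congr rfl fun y hy => by simp only [hV, hy, if_true]
  have sx : ∑ y ∈ s, V y • y = x := by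
    rw [← vx]; exact Finset.sum_congr rfl fun y hy => by simp only [hV, hy, if_true]
  have hh : ∀ z, M.hat z x = V z := fun z => IsBarycentric.hat_eq
    ⟨K, hK, V, V0, fun y hy => Vs y fun h => hy (hs h),
      by rw [← Finset.sum_subset hs fun y _ hy => Vs y hy, s1],
      by rw [← Finset.sum_subset hs fun y _ hy => by rw [Vs y hy, zero_smul], sx], rfl⟩
  simp only [hh]
  exact ⟨V0, Vs, s1, sx⟩

/-- On an element, the hat functions are affine. -/
theorem exists_affine_eq_hat {K : Finset (Pt d)} (hK : K ∈ M.elements) (z : Pt d) :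
    ∃ p : Pt d →ᵃ[ℝ] ℝ, ∀ x ∈ simplex K, M.hat z x = p x := by
  classical
  by_cases hz : z ∈ K
  · obtain ⟨hf, hc⟩ := M.mem_elements.1 hK
    have hi := M.complex.indep hf
    have hspan : affineSpan ℝ (Set.range ((↑) : K → Pt d)) = ⊤ := by
      rw [hi.affineSpan_eq_top_iff_card_eq_finrank_add_one]
      simp [hc]
    -- The `d + 1` independent vertices form an affine basis; its coordinates are affine and, by
    -- uniqueness of the weights, agree with the hat functions on `K`.
    let b : AffineBasis K ℝ (Pt d) := ⟨_, hi, hspan⟩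
    refine ⟨b.coord ⟨z, hz⟩, fun x hx => ?_⟩
    obtain ⟨-, -, h1, h2⟩ := exists_weights_eq_hat hK subset_rfl hx
    have e : ∀ y ∈ K, M.hat y x = if h : y ∈ K then b.coord ⟨y, h⟩ x else 0 := by
      apply eq_zero_off_of_sum_eq hK
      · rw [h1, ← Finset.sum_attach]
        simp only [Finset.coe_mem, dite_true]
        exact (b.sum_coord_apply_eq_one x).symm
      · rw [h2]
        conv_rhs => rw [← Finset.sum_attach]
        simp only [Finset.coe_mem, dite_true]
        exact (b.linear_combination_coord_eq_self x).symm
    rw [e z hz, dif_pos hz]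
  · exact ⟨0, fun x hx => by simpa using (exists_weights_eq_hat hK subset_rfl hx).2.1 z hz⟩

/-! ### Overlaps of elements, patches, and boundary facets. -/

theorem interior_simplex_nonempty {K : Finset (Pt d)} (hK : K ∈ M.elements) :
    (interior (simplex K)).Nonempty := by
  obtain ⟨hf, hc⟩ := M.mem_elements.1 hK
  have hi := M.complex.indep hf
  rw [interior_convexHull_nonempty_iff_affineSpan_eq_top]
  have := (hi.affineSpan_eq_top_iff_card_eq_finrank_add_one).2 (by simp [hc])
  simpa using this

theorem simplex_subset_closure_interior {K : Finset (Pt d)} (hK : K ∈ M.elements) :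
    simplex K ⊆ closure (interior (simplex K)) := by
  rw [(convex_convexHull ℝ _).closure_interior_eq_closure_of_nonempty_interior
    (interior_simplex_nonempty hK)]
  exact subset_closure

/-- At most `d` points span a proper affine subspace, which is a null set. -/
theorem volume_convexHull_eq_zero_of_card_le {s : Finset (Pt d)} (hs : s.card ≤ d) :
    volume (simplex s) = 0 := by
  refine measure_mono_null (convexHull_subset_affineSpan (𝕜 := ℝ) (s : Set (Pt d))) ?_
  apply Measure.addHaar_affineSubspace
  intro h
  have h1 : Module.finrank ℝ (vectorSpan ℝ (s : Set (Pt d))) = d := by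
    rw [← direction_affineSpan, h, AffineSubspace.direction_top]; simp
  -- The empty set is treated apart because `s.card - 1` is a truncated subtraction.
  rcases s.eq_empty_or_nonempty with rfl | hne
  · simp at h
  · have := finrank_vectorSpan_image_finset_le ℝ (id : Pt d → Pt d) s (n := s.card - 1)
      (by have := hne.card_pos; omega)
    have hp := hne.card_pos
    rw [Finset.image_id, h1] at this
    omega

theorem volume_inter_simplex {K L : Finset (Pt d)} (hK : K ∈ M.elements) (hL : L ∈ M.elements)
    (h : K ≠ L) : volume (simplex K ∩ simplex L) = 0 := by
  classical
  obtain ⟨hf, hc⟩ := M.mem_elements.1 hK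
  obtain ⟨hf', hc'⟩ := M.mem_elements.1 hL
  refine measure_mono_null (M.complex.inter_subset_convexHull hf hf') ?_
  rw [← Finset.coe_inter]
  refine volume_convexHull_eq_zero_of_card_le ?_
  by_contra! hlt
  have h1 : K ∩ L = K := Finset.eq_of_subset_of_card_le Finset.inter_subset_left (by omega)
  have h2 : K ∩ L = L := Finset.eq_of_subset_of_card_le Finset.inter_subset_right (by omega)
  exact h (h1.symm.trans h2)

/-- The intersection is an open null set, hence empty. -/
theorem disjoint_interior_simplex {K L : Finset (Pt d)} (hK : K ∈ M.elements)
    (hL : L ∈ M.elements) (h : K ≠ L) :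
    Disjoint (interior (simplex K)) (interior (simplex L)) := by
  rw [Set.disjoint_iff_inter_eq_empty]
  refine (isOpen_interior.inter isOpen_interior).measure_eq_zero_iff volume |>.1 ?_
  exact measure_mono_null (Set.inter_subset_inter interior_subset interior_subset)
    (volume_inter_simplex hK hL h)

theorem piecewise_eq {R : Type*} [AddCommMonoid R] {K : Finset (Pt d)} (hK : K ∈ M.elements)
    (a : Finset (Pt d) → R) {x : Pt d} (hx : x ∈ interior (simplex K)) :
    M.piecewise a x = a K := by
  classical
  rw [piecewise, Finset.sum_eq_single K]
  · simp [hx]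
  · intro L hL hne
    rw [if_neg]
    exact fun h => (disjoint_interior_simplex hL hK hne).le_bot ⟨h, hx⟩
  · exact fun h => absurd hK h

theorem simplex_ae_eq_interior (K : Finset (Pt d)) :
    (interior (simplex K) : Set (Pt d)) =ᵐ[volume] simplex K := by
  refine (interior_ae_eq_of_null_frontier ?_)
  exact (convex_convexHull ℝ _).addHaar_frontier volume

theorem simplex_subset_space {K : Finset (Pt d)} (hK : K ∈ M.elements) :
    simplex K ⊆ M.complex.space :=
  Geometry.SimplicialComplex.convexHull_subset_space (M.mem_elements.1 hK).1

theorem space_subset : M.complex.space ⊆ ⋃ K ∈ M.elements, simplex K := by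
  intro x hx
  obtain ⟨s, hs, hxs⟩ := Geometry.SimplicialComplex.mem_space_iff.1 hx
  obtain ⟨K, hK, hsK⟩ := exists_element_of_mem_faces hs
  exact Set.mem_biUnion hK (convexHull_mono (Finset.coe_subset.2 hsK) hxs)

theorem isCompact_iUnion_simplex (S : Finset (Finset (Pt d))) :
    IsCompact (⋃ K ∈ S, simplex K) :=
  S.isCompact_biUnion fun K _ => isCompact_simplex K

theorem isOpen_domain : IsOpen M.domain := isOpen_interior

theorem isOpen_patch (z : Pt d) : IsOpen (M.patch z) := isOpen_interior

theorem patch_subset (z : Pt d) : M.patch z ⊆ ⋃ K ∈ M.star z, simplex K := interior_subset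

theorem domain_subset : M.domain ⊆ ⋃ K ∈ M.elements, simplex K :=
  interior_subset.trans space_subset

theorem patch_subset_domain (z : Pt d) : M.patch z ⊆ M.domain := by
  refine interior_mono (Set.iUnion₂_subset fun K hK => ?_)
  exact simplex_subset_space (M.mem_star.1 hK).1

theorem interior_simplex_subset_patch {K : Finset (Pt d)} {z : Pt d} (hK : K ∈ M.star z) :
    interior (simplex K) ⊆ M.patch z :=
  interior_mono (Set.subset_biUnion_of_mem (u := fun K => simplex K) hK)

theorem ae_domain : ∀ᵐ x ∂(volume.restrict M.domain), ∃ K ∈ M.elements,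
    x ∈ interior (simplex K) := by
  rw [ae_restrict_iff' isOpen_domain.measurableSet]
  have : ∀ᵐ x ∂(volume : Measure (Pt d)), ∀ K ∈ M.elements,
      x ∈ simplex K → x ∈ interior (simplex K) := by
    rw [Filter.eventually_all_finset]
    intro K _
    filter_upwards [simplex_ae_eq_interior K] with x hx hxK
    exact (iff_of_eq hx).2 hxK
  filter_upwards [this] with x hx hxd
  obtain ⟨K, hK, hxK⟩ := Set.mem_iUnion₂.1 (domain_subset hxd)
  exact ⟨K, hK, hx K hK hxK⟩

/-- An open element is disjoint from the patches of the nodes that are not its vertices. -/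
theorem disjoint_interior_simplex_patch {K : Finset (Pt d)} (hK : K ∈ M.elements) {z : Pt d}
    (hz : z ∉ K) : Disjoint (interior (simplex K)) (M.patch z) := by
  rw [Set.disjoint_iff_inter_eq_empty]
  refine (isOpen_interior.inter (isOpen_patch z)).measure_eq_zero_iff volume |>.1 ?_
  refine measure_mono_null (Set.inter_subset_inter interior_subset (patch_subset z)) ?_
  rw [Set.inter_iUnion₂]
  refine (measure_biUnion_null_iff (M.star z).countable_toSet).2 fun L hL => ?_
  obtain ⟨hL, hzL⟩ := M.mem_star.1 hL
  exact volume_inter_simplex hK hL fun h => hz (h ▸ hzL)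

/-- Inside an open element, membership in a patch becomes combinatorial; this turns sums over all
nodes into sums over the vertices of `K`. -/
theorem mem_patch_iff {K : Finset (Pt d)} (hK : K ∈ M.elements) {x z : Pt d}
    (hx : x ∈ interior (simplex K)) : x ∈ M.patch z ↔ z ∈ K := by
  refine ⟨fun h => ?_, fun h => interior_simplex_subset_patch (M.mem_star.2 ⟨hK, h⟩) hx⟩
  by_contra hz
  exact (disjoint_interior_simplex_patch hK hz).le_bot ⟨hx, h⟩

/-- A facet on `∂Ω` lies on the boundary of the patches of its vertices. -/
theorem simplex_subset_frontier_patch {E : Finset (Pt d)} (hE : E ∈ M.boundaryFacets M.domain)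
    {z : Pt d} (hz : z ∈ E) : simplex E ⊆ frontier (M.patch z) := by
  obtain ⟨hE, hEf⟩ := M.mem_boundaryFacets.1 hE
  obtain ⟨K, hK, hEK⟩ := exists_element_of_mem_facets hE
  intro x hx
  rw [(isOpen_patch z).frontier_eq]
  constructor
  · exact closure_mono (interior_simplex_subset_patch (M.mem_star.2 ⟨hK, hEK hz⟩))
      (simplex_subset_closure_interior hK (convexHull_mono (Finset.coe_subset.2 hEK) hx))
  · have := hEf hx
    rw [isOpen_domain.frontier_eq] at this
    exact fun h => this.2 (patch_subset_domain z h)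

/-- A point of `Ω` where the hat function of `z` is positive belongs to the patch of `z`. -/
theorem mem_patch_of_hat_pos {x z : Pt d} (hxd : x ∈ M.domain) (hpos : 0 < M.hat z x) : x ∈ M.patch z := by
  classical
  -- Near `x` only elements that contain `x` occur. Each of them has `z` as a vertex, since
  -- otherwise the hat function of `z` would vanish at `x`.
  set S := M.elements.filter (fun K => x ∉ simplex K) with hS
  have hclosed : IsClosed (⋃ K ∈ S, simplex K) := (isCompact_iUnion_simplex S).isClosed
  have hxS : x ∉ ⋃ K ∈ S, simplex K := by
    rw [Set.mem_iUnion₂]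
    rintro ⟨K, hK, hxK⟩
    exact (Finset.mem_filter.1 hK).2 hxK
  rw [patch, mem_interior_iff_mem_nhds]
  filter_upwards [hclosed.isOpen_compl.mem_nhds hxS, isOpen_domain.mem_nhds hxd] with y hy hyd
  obtain ⟨K, hK, hyK⟩ := Set.mem_iUnion₂.1 (domain_subset hyd)
  have hxK : x ∈ simplex K := by
    by_contra h
    exact hy (Set.mem_biUnion (Finset.mem_coe.2 (Finset.mem_filter.2 ⟨hK, h⟩)) hyK)
  have hzK : z ∈ K := by
    by_contra h
    exact hpos.ne' ((exists_weights_eq_hat hK subset_rfl hxK).2.1 z h)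
  exact Set.mem_biUnion (Finset.mem_coe.2 (M.mem_star.2 ⟨hK, hzK⟩)) hyK

/-- A facet on `∂ω_z` that contains `z` lies on `∂Ω`. -/
theorem mem_boundaryFacets_domain {E : Finset (Pt d)} {z : Pt d}
    (hE : E ∈ M.boundaryFacets (M.patch z)) (hz : z ∈ E) : E ∈ M.boundaryFacets M.domain := by
  obtain ⟨hE, hEf⟩ := M.mem_boundaryFacets.1 hE
  refine M.mem_boundaryFacets.2 ⟨hE, ?_⟩
  obtain ⟨K, hK, hEK⟩ := exists_element_of_mem_facets hE
  have hsub : simplex E ⊆ simplex K := convexHull_mono (Finset.coe_subset.2 hEK)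
  obtain ⟨p, hp⟩ := exists_affine_eq_hat hK z
  have hzE : z ∈ simplex E := subset_convexHull ℝ _ hz
  have hpz : p z = 1 := by
    rw [← hp z (hsub hzE)]
    have hs : ({z} : Finset (Pt d)) ⊆ K := by simpa using hEK hz
    simpa using (exists_weights_eq_hat hK hs (x := z)
      (by simp [simplex])).2.2.1
  intro x hx
  rw [isOpen_domain.frontier_eq]
  have hfr := hEf hx
  rw [(isOpen_patch z).frontier_eq] at hfr
  refine ⟨closure_mono (patch_subset_domain z) hfr.1, fun hxd => ?_⟩
  -- The hat function of `z` may vanish at `x` itself, so `x` is moved slightly towards `z`. The new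
  -- point `y` stays in `E` and in `Ω`, and the hat function is positive there. Thus `y` lies in the
  -- open patch, although `E` lies on its frontier.
  have hlim : Tendsto (fun t : ℝ => AffineMap.lineMap x z t) (𝓝[>] 0) (𝓝 x) := by
    have hc : Continuous (fun t : ℝ => AffineMap.lineMap x z t) := AffineMap.lineMap_continuous
    simpa using (hc.tendsto 0).mono_left nhdsWithin_le_nhds
  obtain ⟨t, htd, ht0, ht1⟩ := ((hlim.eventually (isOpen_domain.mem_nhds hxd)).and
    (Ioo_mem_nhdsGT (zero_lt_one' ℝ))).exists
  set y : Pt d := AffineMap.lineMap x z t with hy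
  have hyE : y ∈ simplex E :=
    (convex_convexHull ℝ _).lineMap_mem hx hzE ⟨ht0.le, ht1.le⟩
  have hpos : 0 < M.hat z y := by
    rw [hp y (hsub hyE), hy, AffineMap.apply_lineMap, hpz, AffineMap.lineMap_apply]
    have h0 : 0 ≤ p x := by
      rw [← hp x (hsub hx)]; exact (exists_weights_eq_hat hK hEK hx).1 z
    simp only [vsub_eq_sub, smul_eq_mul, vadd_eq_add]
    nlinarith
  have hyf := hEf hyE
  rw [(isOpen_patch z).frontier_eq] at hyf
  exact hyf.2 (mem_patch_of_hat_pos htd hpos)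

end SimplicialMesh

/-! ### Surface measure, integrability, and divergences of `RT₁` fields. -/

/-- The surface measure of a facet is finite. -/
theorem euclideanHausdorffMeasure_simplex_lt_top {n : ℕ} {s : Finset (Pt d)}
    (hs : AffineIndependent ℝ ((↑) : s → Pt d)) (hc : s.card = n + 1) :
    (μHE[n] : Measure (Pt d)) (simplex s) < ⊤ := by
  obtain ⟨p, hp⟩ : s.Nonempty := Finset.card_pos.1 (by omega)
  -- The affine hull of `s` is isometric to its `n`-dimensional direction, where the measure is the
  -- Lebesgue measure and hence finite on compact sets.
  set A := affineSpan ℝ (s : Set (Pt d)) with hA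
  have hpA : p ∈ A := mem_affineSpan ℝ (Finset.mem_coe.2 hp)
  have : Nonempty A := ⟨⟨p, hpA⟩⟩
  have hrank : Module.finrank ℝ A.direction = n := by
    rw [hA, direction_affineSpan]
    have := hs.finrank_vectorSpan (n := n) (by simpa using hc)
    rwa [Subtype.range_coe_subtype] at this
  have hsub : simplex s ⊆ A := convexHull_subset_affineSpan _
  have himg : simplex s = Subtype.val '' (Subtype.val ⁻¹' simplex s : Set A) := by
    exact ((Subtype.image_preimage_coe (A : Set (Pt d)) (simplex s)).trans
      (Set.inter_eq_right.2 hsub)).symm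
  have hcomp : IsCompact (Subtype.val ⁻¹' simplex s : Set A) := by
    have hcl : IsClosed (A : Set (Pt d)) := A.closed_of_finiteDimensional
    exact hcl.isClosedEmbedding_subtypeVal.isCompact_preimage (isCompact_simplex s)
  rw [himg, AffineSubspace.euclideanHausdorffMeasure_coe_image, ← hrank,
    EuclideanGeometry.euclideanHausdorffMeasure_eq (⟨p, hpA⟩ : A),
    Measure.map_apply (IsometryEquiv.vaddConst _).continuous.measurable hcomp.measurableSet]
  exact ((IsometryEquiv.vaddConst (⟨p, hpA⟩ : A)).toHomeomorph.isCompact_preimage.2 hcomp).measure_lt_top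


theorem integrable_inner_of_memLp {μ : Measure (Pt d)} {σ τ : Pt d → Pt d} (hσ : MemLp σ 2 μ)
    (hτ : MemLp τ 2 μ) : Integrable (fun x => inner ℝ (σ x) (τ x)) μ := by
  have h : Integrable (fun x => ‖σ x‖ * ‖τ x‖) μ := hσ.norm.integrable_mul hτ.norm
  exact h.mono' (hσ.1.inner hτ.1) (ae_of_all _ fun x => norm_inner_le_norm _ _)

theorem memLp_of_continuous {F : Type*} [NormedAddCommGroup F] [SecondCountableTopology F]
    {μ : Measure (Pt d)} {g : Pt d → F} (hg : Continuous g) {C : Set (Pt d)} (hC : IsCompact C)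
    (hμ : μ C < ⊤) {D : Set (Pt d)} (hD : D ⊆ C) (p : ENNReal) : MemLp g p (μ.restrict D) := by
  have h : MemLp g p (μ.restrict C) := by
    have : IsFiniteMeasure (μ.restrict C) := ⟨by simpa using hμ⟩
    obtain ⟨B, hB⟩ := hC.exists_bound_of_continuousOn hg.continuousOn
    exact MemLp.of_bound hg.aestronglyMeasurable B
      ((ae_restrict_iff' hC.measurableSet).2 (ae_of_all _ hB))
  exact h.mono_measure (Measure.restrict_mono_set _ hD)

theorem continuous_gradient {v : Pt d → ℝ} (hv : ContDiff ℝ ∞ v) : Continuous (gradient v) :=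
  (InnerProductSpace.toDual ℝ (Pt d)).symm.continuous.comp (hv.continuous_fderiv (by simp))

theorem continuous_affine {F : Type*} [NormedAddCommGroup F] [NormedSpace ℝ F]
    (p : Pt d →ᵃ[ℝ] F) : Continuous p := p.continuous_of_finiteDimensional

theorem inner_gradient_eq_sum (τ : Pt d) (φ : Pt d → ℝ) (x : Pt d) :
    inner ℝ τ (gradient φ x)
      = ∑ i, τ i * fderiv ℝ φ x (EuclideanSpace.single i 1) := by
  have h : inner ℝ τ (gradient φ x) = fderiv ℝ φ x τ := by
    rw [real_inner_comm]
    exact inner_gradient_left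
  rw [h]
  conv_lhs => rw [← (EuclideanSpace.basisFun (Fin d) ℝ).sum_repr τ]
  simp

theorem affineMap_sum_apply {F ι : Type*} [AddCommGroup F] [Module ℝ F] (s : Finset ι)
    (q : ι → Pt d →ᵃ[ℝ] F) (x : Pt d) : (∑ i ∈ s, q i) x = ∑ i ∈ s, q i x := by
  classical
  induction s using Finset.induction_on with
  | empty => simp
  | insert i s hi ih => rw [Finset.sum_insert hi, Finset.sum_insert hi, ← ih]; rfl

/-- The divergence of a field in `RT₁` is affine. -/
theorem exists_affine_divergence (a : Pt d →ᵃ[ℝ] Pt d) (p : Pt d →ᵃ[ℝ] ℝ) :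
    ∃ q : Pt d →ᵃ[ℝ] ℝ, ∀ φ : Pt d → ℝ, ContDiff ℝ ∞ φ → HasCompactSupport φ →
      ∫ x, inner ℝ (a x + p x • x) (gradient φ x) = -∫ x, q x * φ x := by
  let pr : Fin d → Pt d →ₗ[ℝ] ℝ := fun i => (EuclideanSpace.proj i : Pt d →L[ℝ] ℝ).toLinearMap
  let e : Fin d → Pt d := fun i => EuclideanSpace.single i 1
  -- `q i` is the `i`-th partial derivative of the `i`-th component `a x i + p x * x i`. The field
  -- is quadratic, but this derivative is affine because `p.linear (e i)` is a constant.
  let q : Fin d → Pt d →ᵃ[ℝ] ℝ := fun i =>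
    AffineMap.const ℝ (Pt d) (a.linear (e i) i) + p + (p.linear (e i)) • (pr i).toAffineMap
  refine ⟨∑ i, q i, fun φ hφ hc => ?_⟩
  let τ : Fin d → Pt d → ℝ := fun i x => a x i + p x * x i
  have hderiv : ∀ i x, HasFDerivAt (τ i)
      ((EuclideanSpace.proj i : Pt d →L[ℝ] ℝ).comp (a.linear.toContinuousLinearMap)
        + (p x • (EuclideanSpace.proj i : Pt d →L[ℝ] ℝ)
          + x i • p.linear.toContinuousLinearMap)) x := by
    intro i x
    have ha : HasFDerivAt a a.linear.toContinuousLinearMap x := by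
      have := (a.linear.toContinuousLinearMap.hasFDerivAt (x := x)).add_const (a 0)
      refine this.congr_of_eventuallyEq (Eventually.of_forall fun y => ?_)
      rw [a.decomp]; simp
    have hp : HasFDerivAt p p.linear.toContinuousLinearMap x := by
      have := (p.linear.toContinuousLinearMap.hasFDerivAt (x := x)).add_const (p 0)
      refine this.congr_of_eventuallyEq (Eventually.of_forall fun y => ?_)
      rw [p.decomp]; simp
    exact ((EuclideanSpace.proj i : Pt d →L[ℝ] ℝ).hasFDerivAt.comp x ha).add
      (hp.mul (EuclideanSpace.proj i : Pt d →L[ℝ] ℝ).hasFDerivAt)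
  have hdiv : ∀ i x, fderiv ℝ (τ i) x (e i) = q i x := by
    intro i x
    rw [(hderiv i x).fderiv]
    simp [q, e, pr]
    ring
  have hτc : ∀ i, Continuous (τ i) := fun i =>
    continuous_iff_continuousAt.2 fun x => (hderiv i x).continuousAt
  have hdφ : ∀ i, Continuous fun x => fderiv ℝ φ x (e i) := fun i =>
    (hφ.continuous_fderiv (by simp)).clm_apply continuous_const
  have hcφ : ∀ i, HasCompactSupport fun x => fderiv ℝ φ x (e i) := fun i =>
    hc.fderiv_apply ℝ (e i)
  have hi1 : ∀ i, Integrable fun x => τ i x * fderiv ℝ φ x (e i) := fun i =>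
    ((hτc i).mul (hdφ i)).integrable_of_hasCompactSupport (hcφ i).mul_left
  have hi2 : ∀ i, Integrable fun x => q i x * φ x := fun i =>
    ((continuous_affine (q i)).mul hφ.continuous).integrable_of_hasCompactSupport hc.mul_left
  have hi3 : ∀ i, Integrable fun x => τ i x * φ x := fun i =>
    ((hτc i).mul hφ.continuous).integrable_of_hasCompactSupport hc.mul_left
  calc ∫ x, inner ℝ (a x + p x • x) (gradient φ x)
      = ∫ x, ∑ i, τ i x * fderiv ℝ φ x (e i) := by
        refine integral_congr_ae (ae_of_all _ fun x => ?_)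
        exact inner_gradient_eq_sum _ _ _
    _ = ∑ i, ∫ x, τ i x * fderiv ℝ φ x (e i) := integral_finsetSum _ fun i _ => hi1 i
    _ = ∑ i, -∫ x, q i x * φ x := by
        refine Finset.sum_congr rfl fun i _ => ?_
        rw [integral_mul_fderiv_eq_neg_fderiv_mul_of_integrable]
        · simp only [hdiv]
        · simpa only [hdiv] using hi2 i
        · exact hi1 i
        · exact hi3 i
        · exact fun x _ => (hderiv i x).differentiableAt
        · exact fun x _ => hφ.differentiable (by simp) x
    _ = -∫ x, (∑ i, q i) x * φ x := by
        rw [Finset.sum_neg_distrib, ← integral_finsetSum _ fun i _ => hi2 i]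
        congr 2
        funext x
        rw [affineMap_sum_apply, Finset.sum_mul]

theorem setIntegral_eq_integral_of_support_subset {F : Type*} [NormedAddCommGroup F]
    [NormedSpace ℝ F] {D : Set (Pt d)} {g : Pt d → F}
    (h : Function.support g ⊆ D) : ∫ x in D, g x = ∫ x, g x :=
  setIntegral_eq_integral_of_forall_compl_eq_zero fun x hx => by
    by_contra hne
    exact hx (h hne)

/-- The weak divergence of a field that belongs to `RT₁(K)` is affine on `K`. -/
theorem IsRT1On.isP1On_div {K : Finset (Pt d)} {D : Set (Pt d)} {σ : Pt d → Pt d} {f : Pt d → ℝ}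
    (hK : interior (simplex K) ⊆ D) (hσ : IsRT1On K σ) (hf : MemHdiv D σ f) :
    IsP1On K f := by
  obtain ⟨a, p, hap⟩ := hσ
  obtain ⟨q, hq⟩ := exists_affine_divergence a p
  refine ⟨q, ?_⟩
  have hUK : interior (simplex K) ⊆ simplex K := interior_subset
  have hloc : LocallyIntegrableOn (fun x => f x - q x) (interior (simplex K)) volume := by
    have h1 : MemLp f 2 (volume.restrict (interior (simplex K))) :=
      hf.memLp_div.mono_measure (Measure.restrict_mono_set _ hK)
    have h2 : MemLp q 2 (volume.restrict (interior (simplex K))) :=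
      memLp_of_continuous (continuous_affine q) (isCompact_simplex K)
        (isCompact_simplex K).measure_lt_top hUK 2
    have hfin : IsFiniteMeasure (volume.restrict (interior (simplex K))) :=
      ⟨by simpa using (measure_mono hUK).trans_lt (isCompact_simplex K).measure_lt_top⟩
    have h : IntegrableOn (fun x => f x - q x) (interior (simplex K)) volume :=
      (h1.sub h2).integrable (by norm_num)
    exact h.locallyIntegrableOn
  -- A test function supported in the open element sees only the `RT₁` polynomial. Hence `f - q` is
  -- orthogonal to all of them and vanishes a.e.; the frontier of the simplex is null.
  have key : ∀ g : Pt d → ℝ, ContDiff ℝ ∞ g → HasCompactSupport g →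
      tsupport g ⊆ interior (simplex K) → ∫ x, g x • (f x - q x) = 0 := by
    intro g hg hgc hgs
    have hd := hf.hasWeakDiv g ⟨hg, hgc, hgs.trans hK⟩
    have hgrad : ∀ x, x ∉ tsupport g → gradient g x = 0 := by
      intro x hx
      have : fderiv ℝ g x = 0 := by
        by_contra hne
        exact hx (support_fderiv_subset ℝ hne)
      simp [gradient, this]
    have e1 : ∫ x in D, inner ℝ (σ x) (gradient g x)
        = ∫ x, inner ℝ (a x + p x • x) (gradient g x) := by
      rw [setIntegral_eq_integral_of_support_subset]
      · refine integral_congr_ae ?_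
        filter_upwards [(ae_restrict_iff' (measurableSet_simplex K)).1 hap] with x hx
        by_cases hxK : x ∈ tsupport g
        · rw [hx (hUK (hgs hxK))]
        · simp [hgrad x hxK]
      · intro x hx
        refine hK (hgs ?_)
        by_contra h
        exact hx (by simp [hgrad x h])
    have hsupp : Function.support (fun x => f x * g x) ⊆ D := by
      intro x hx
      exact hK (hgs (subset_tsupport g (right_ne_zero_of_mul hx)))
    rw [e1, hq g hg hgc, setIntegral_eq_integral_of_support_subset hsupp, neg_inj] at hd
    have i1 : Integrable fun x => q x * g x :=
      ((continuous_affine q).mul hg.continuous).integrable_of_hasCompactSupport hgc.mul_left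
    have i2 : Integrable fun x => f x * g x := by
      rw [← integrableOn_iff_integrable_of_support_subset hsupp]
      exact hf.memLp_div.integrable_mul
        ((hg.continuous.memLp_of_hasCompactSupport (p := 2) hgc).restrict D)
    calc ∫ x, g x • (f x - q x) = ∫ x, (f x * g x - q x * g x) := by
          congr 1; funext x; simp only [smul_eq_mul]; ring
      _ = 0 := by rw [integral_sub i2 i1, hd, sub_self]
  have hae := isOpen_interior.ae_eq_zero_of_integral_contDiff_smul_eq_zero hloc key
  rw [ae_restrict_iff' (measurableSet_simplex K)]
  filter_upwards [hae, SimplicialMesh.simplex_ae_eq_interior K] with x hx hxe hxK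
  exact sub_eq_zero.1 (hx ((iff_of_eq hxe).2 hxK))


/-! ### Sums of functions on the patches -/

namespace SimplicialMesh

variable {M : SimplicialMesh d}

open scoped Classical in
/-- The sum of functions on the patches, extended by zero. -/
noncomputable def extSum {F : Type*} [AddCommMonoid F] (M : SimplicialMesh d)
    (g : Pt d → Pt d → F) (x : Pt d) : F :=
  ∑ z ∈ M.nodes, if x ∈ M.patch z then g z x else 0

theorem extSum_eq_sum {F : Type*} [AddCommMonoid F] (g : Pt d → Pt d → F) {K : Finset (Pt d)}
    (hK : K ∈ M.elements) {x : Pt d} (hx : x ∈ interior (simplex K)) :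
    M.extSum g x = ∑ z ∈ K, g z x := by
  classical
  have hsub : K ⊆ M.nodes := fun z hz => M.mem_nodes.2 ⟨K, hK, hz⟩
  rw [extSum, ← Finset.sum_subset hsub]
  · exact Finset.sum_congr rfl fun z hz => if_pos ((mem_patch_iff hK hx).2 hz)
  · exact fun z _ hz => if_neg fun h => hz ((mem_patch_iff hK hx).1 h)

theorem extSum_eq_sum_indicator {F : Type*} [AddCommMonoid F] (g : Pt d → Pt d → F) :
    M.extSum g = fun x => ∑ z ∈ M.nodes, (M.patch z).indicator (g z) x := by
  classical
  funext x
  simp only [extSum, Set.indicator_apply]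

theorem memLp_extSum {F : Type*} [NormedAddCommGroup F] {g : Pt d → Pt d → F} {p : ENNReal}
    (hg : ∀ z ∈ M.nodes, MemLp (g z) p (volume.restrict (M.patch z))) :
    MemLp (M.extSum g) p (volume.restrict M.domain) := by
  rw [extSum_eq_sum_indicator]
  refine memLp_finsetSum _ fun z hz => ?_
  exact ((memLp_indicator_iff_restrict (isOpen_patch z).measurableSet).2 (hg z hz)).restrict _

theorem integral_extSum {F : Type*} [NormedAddCommGroup F] [NormedSpace ℝ F]
    {g : Pt d → Pt d → F} (hg : ∀ z ∈ M.nodes, IntegrableOn (g z) (M.patch z)) :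
    ∫ x in M.domain, M.extSum g x = ∑ z ∈ M.nodes, ∫ x in M.patch z, g z x := by
  rw [extSum_eq_sum_indicator, integral_finsetSum]
  · refine Finset.sum_congr rfl fun z _ => ?_
    rw [setIntegral_indicator (isOpen_patch z).measurableSet,
      Set.inter_eq_right.2 (patch_subset_domain z)]
  · intro z hz
    exact ((integrable_indicator_iff (isOpen_patch z).measurableSet).2 (hg z hz)).restrict

theorem memLp_domain_of_continuous {F : Type*} [NormedAddCommGroup F]
    [SecondCountableTopology F] {g : Pt d → F} (hg : Continuous g) (p : ENNReal) :
    MemLp g p (volume.restrict M.domain) :=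
  memLp_of_continuous hg (isCompact_iUnion_simplex M.elements)
    (isCompact_iUnion_simplex M.elements).measure_lt_top domain_subset p

theorem memLp_patch_of_continuous {F : Type*} [NormedAddCommGroup F]
    [SecondCountableTopology F] {g : Pt d → F} (hg : Continuous g) (p : ENNReal) (z : Pt d) :
    MemLp g p (volume.restrict (M.patch z)) :=
  (memLp_domain_of_continuous (M := M) hg p).mono_measure
    (Measure.restrict_mono_set _ (patch_subset_domain z))

theorem integrable_facet_of_continuous (hd : 2 ≤ d) {E : Finset (Pt d)} (hE : E ∈ M.facets)
    {g : Pt d → ℝ} (hg : Continuous g) : Integrable g ((μHE[d - 1]).restrict (simplex E)) := by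
  obtain ⟨hf, hc⟩ := M.mem_facets.1 hE
  exact memLp_one_iff_integrable.1 (memLp_of_continuous hg (isCompact_simplex E)
    (euclideanHausdorffMeasure_simplex_lt_top (M.complex.indep hf) (by omega)) subset_rfl 1)

/-! ### Gradients of piecewise affine functions -/

theorem exists_gradient_eq_of_eqOn {K : Finset (Pt d)} {f : Pt d → ℝ} {p : Pt d →ᵃ[ℝ] ℝ}
    (h : ∀ x ∈ simplex K, f x = p x) :
    ∃ g : Pt d, ∀ x ∈ interior (simplex K), HasGradientAt f g x := by
  refine ⟨(InnerProductSpace.toDual ℝ (Pt d)).symm p.linear.toContinuousLinearMap,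
    fun x hx => ?_⟩
  rw [hasGradientAt_iff_hasFDerivAt, LinearIsometryEquiv.apply_symm_apply]
  have := (p.linear.toContinuousLinearMap.hasFDerivAt (x := x)).add_const (p 0)
  refine this.congr_of_eventuallyEq ?_
  filter_upwards [isOpen_interior.mem_nhds hx] with y hy
  rw [h y (interior_subset hy), p.decomp]
  simp

/-- The sum of the hat functions is the constant `1` on `K`. This is what cancels the terms with
`𝒜∇ψ_z`. -/
theorem sum_gradient_hat {K : Finset (Pt d)} (hK : K ∈ M.elements) {g : Pt d → Pt d}
    {x : Pt d} (hx : x ∈ interior (simplex K)) (hg : ∀ z ∈ K, HasGradientAt (M.hat z) (g z) x) :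
    ∑ z ∈ K, g z = 0 := by
  have h1 : HasFDerivAt (fun y => ∑ z ∈ K, M.hat z y)
      (∑ z ∈ K, InnerProductSpace.toDual ℝ (Pt d) (g z)) x :=
    HasFDerivAt.fun_sum fun z hz => hasGradientAt_iff_hasFDerivAt.1 (hg z hz)
  have h2 : HasFDerivAt (fun y => ∑ z ∈ K, M.hat z y) (0 : Pt d →L[ℝ] ℝ) x := by
    refine (hasFDerivAt_const (1 : ℝ) x).congr_of_eventuallyEq ?_
    filter_upwards [isOpen_interior.mem_nhds hx] with y hy
    exact (exists_weights_eq_hat hK subset_rfl (interior_subset hy)).2.2.1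
  have h3 := h1.unique h2
  rw [← map_sum] at h3
  exact (map_eq_zero_iff _ (InnerProductSpace.toDual ℝ (Pt d)).injective).1 h3

end SimplicialMesh

/-! ### Summation of the local flux and divergence conditions. -/

open SimplicialMesh

theorem ae_eq_zero_of_integral_mul_self {μ : Measure (Pt d)} {r : Pt d → ℝ}
    (hi : Integrable (fun x => r x * r x) μ) (h : ∫ x, r x * r x ∂μ = 0) :
    ∀ᵐ x ∂μ, r x = 0 := by
  have := (integral_eq_zero_iff_of_nonneg (fun x => mul_self_nonneg (r x)) hi).1 h
  filter_upwards [this] with x hx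
  exact mul_self_eq_zero.1 hx

/-- The projections of `ψ_z u` onto `P₁(E)` add up to `u`. -/
theorem sum_facetProjection_ae_eq {M : SimplicialMesh d} (hd : 2 ≤ d) {E : Finset (Pt d)}
    (hE : E ∈ M.facets) {u : Pt d → ℝ}
    (hu : ∀ K ∈ M.elements, ∃ p : Pt d →ᵃ[ℝ] ℝ, ∀ x ∈ simplex K, u x = p x)
    {p : Pt d → Pt d →ᵃ[ℝ] ℝ}
    (hp : ∀ z ∈ E, IsFacetProjection E (fun x => M.hat z x * u x) (p z)) :
    ∀ᵐ x ∂((μHE[d - 1]).restrict (simplex E)), ∑ z ∈ E, p z x = u x := by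
  obtain ⟨K, hK, hEK⟩ := exists_element_of_mem_facets hE
  have hsub : simplex E ⊆ simplex K := convexHull_mono (Finset.coe_subset.2 hEK)
  obtain ⟨pu, hpu⟩ := hu K hK
  choose l hl using fun z => exists_affine_eq_hat hK z
  -- The residual `r` is itself in `P₁(E)`, so it may test every projection identity. The hat
  -- functions of the vertices of `E` add up to `1` on `E`, so the sum of these identities reads `∫
  -- r² = 0`.
  set r : Pt d →ᵃ[ℝ] ℝ := pu - ∑ z ∈ E, p z with hr
  have hrx : ∀ x, r x = pu x - ∑ z ∈ E, p z x := by
    intro x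
    rw [← affineMap_sum_apply]; rfl
  have hc := fun (q : Pt d →ᵃ[ℝ] ℝ) => continuous_affine q
  have hae : ∀ᵐ x ∂((μHE[d - 1]).restrict (simplex E)), x ∈ simplex E :=
    ae_restrict_mem (measurableSet_simplex E)
  have h1 : ∀ z ∈ E, ∫ x in simplex E, (l z x * pu x - p z x) * r x ∂(μHE[d - 1]) = 0 := by
    intro z hz
    rw [← hp z hz r]
    refine setIntegral_congr_fun (measurableSet_simplex E) fun x hx => ?_
    simp only [hl z x (hsub hx), hpu x (hsub hx)]
  have h2 : ∫ x in simplex E, r x * r x ∂(μHE[d - 1]) = 0 := by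
    rw [← Finset.sum_eq_zero h1, ← integral_finsetSum]
    · refine setIntegral_congr_fun (measurableSet_simplex E) fun x hx => ?_
      rw [← Finset.sum_mul, Finset.sum_sub_distrib, ← Finset.sum_mul]
      have : ∑ z ∈ E, l z x = 1 := by
        rw [← (exists_weights_eq_hat hK hEK hx).2.2.1]
        exact Finset.sum_congr rfl fun z _ => (hl z x (hsub hx)).symm
      rw [this, one_mul, hrx]
    · exact fun z _ => integrable_facet_of_continuous hd hE
        ((((hc (l z)).mul (hc pu)).sub (hc (p z))).mul (hc r))
  filter_upwards [ae_eq_zero_of_integral_mul_self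
    (integrable_facet_of_continuous hd hE ((hc r).mul (hc r))) h2, hae] with x hx hxE
  rw [hrx] at hx
  rw [hpu x (hsub hxE)]
  linarith

namespace EigenProblem

variable {P : EigenProblem d}

/-- The condition that the facet lie on `∂ω_z` is automatic for a facet on `∂Ω` with vertex `z`. -/
theorem mem_localNeumannPlus {z : Pt d} {E : Finset (Pt d)} :
    E ∈ P.localNeumannPlus z ↔ E ∈ P.neumannPlus ∧ z ∈ E := by
  simp only [localNeumannPlus, Finset.mem_filter]
  refine ⟨fun h => ⟨h.1, h.2.2⟩, fun h => ⟨h.1, ?_, h.2⟩⟩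
  have hb := P.neumann_subset (Finset.mem_filter.1 h.1).1
  exact P.mesh.mem_boundaryFacets.2 ⟨(P.mesh.mem_boundaryFacets.1 hb).1,
    simplex_subset_frontier_patch hb h.2⟩

theorem neumannPlus_subset : P.neumannPlus ⊆ P.neumann := by
  classical
  exact Finset.filter_subset _ _

/-- The facets on `∂ω_z` without prescribed flux lie on `Γ_D`. -/
theorem mem_boundaryFacets_of_notMem_prescribedFacets {z : Pt d} {E : Finset (Pt d)}
    (hE : E ∈ P.mesh.boundaryFacets (P.mesh.patch z)) (hEz : E ∉ P.prescribedFacets z) :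
    E ∈ P.mesh.boundaryFacets P.Ω ∧ E ∉ P.neumann := by
  classical
  simp only [prescribedFacets, Finset.mem_union, not_or] at hEz
  obtain ⟨⟨h1, h2⟩, h3⟩ := hEz
  have hz : z ∈ E := by
    by_contra hz
    exact h1 (by simp [outerFacets, hE, hz])
  -- A Neumann facet containing `z` would belong to one of the two local Neumann families, and so be
  -- prescribed.
  refine ⟨mem_boundaryFacets_domain hE hz, fun hN => ?_⟩
  by_cases hp : E ∈ P.neumannPlus
  · exact h3 (mem_localNeumannPlus.2 ⟨hp, hz⟩)
  · exact h2 (by simp [localNeumannZero, neumannZero, hN, hp, hE, hz])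

/-- `Q_z` requires no continuity, so the divergence equation can be tested on one element at a time.
-/
theorem memQz_indicator {K : Finset (Pt d)} (hK : K ∈ P.mesh.elements) (z : Pt d)
    (r : Pt d →ᵃ[ℝ] ℝ) : P.MemQz z ((interior (simplex K)).indicator r) := by
  constructor
  · exact ((memLp_indicator_iff_restrict isOpen_interior.measurableSet).2
      (memLp_of_continuous (continuous_affine r) (isCompact_simplex K)
        (isCompact_simplex K).measure_lt_top interior_subset 2)).restrict _
  · intro L hL
    have hLe := (P.mesh.mem_star.1 hL).1
    by_cases h : L = K
    · subst h
      refine ⟨r, (ae_restrict_iff' (measurableSet_simplex L)).2 ?_⟩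
      filter_upwards [simplex_ae_eq_interior L] with x hx hxL
      have hxi : x ∈ interior (simplex L) := (iff_of_eq hx).2 hxL
      simp [hxi]
    · refine ⟨0, (ae_restrict_iff' (measurableSet_simplex L)).2 ?_⟩
      filter_upwards [simplex_ae_eq_interior L] with x hx hxL
      have hxK : x ∉ interior (simplex K) := fun hxK =>
        (disjoint_interior_simplex hLe hK h).le_bot ⟨(iff_of_eq hx).2 hxL, hxK⟩
      simp [hxK]

theorem setIntegral_patch_mul_indicator {K : Finset (Pt d)} {z : Pt d}
    (hK : K ∈ P.mesh.star z) (g r : Pt d → ℝ) :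
    ∫ x in P.mesh.patch z, g x * (interior (simplex K)).indicator r x
      = ∫ x in interior (simplex K), g x * r x := by
  have : (fun x => g x * (interior (simplex K)).indicator r x)
      = (interior (simplex K)).indicator (fun x => g x * r x) := by
    funext x
    by_cases hx : x ∈ interior (simplex K) <;> simp [hx]
  rw [this, setIntegral_indicator isOpen_interior.measurableSet,
    Set.inter_eq_right.2 (interior_simplex_subset_patch hK)]

/-- The second equations of the local problems add up to the divergence constraint. -/
theorem sum_div_ae_eq {Λ : ℝ} {u : Pt d → ℝ} {K : Finset (Pt d)} (hK : K ∈ P.mesh.elements)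
    (hu : ∃ p : Pt d →ᵃ[ℝ] ℝ, ∀ x ∈ simplex K, u x = p x) {f : Pt d → Pt d → ℝ}
    (hf : ∀ z ∈ K, IsP1On K (f z))
    (heq : ∀ z ∈ K, ∀ φ : Pt d → ℝ, P.MemQz z φ →
      ∫ x in P.mesh.patch z, f z x * φ x
        = (∫ x in P.mesh.patch z,
            (P.cFun x - Λ * P.β₁Fun x) / (Λ + P.γ) * (P.mesh.hat z x * u x) * φ x) +
          ∫ x in P.mesh.patch z,
            inner ℝ (P.applyA (gradient (P.mesh.hat z)) x) (gradient u x) / (Λ + P.γ) * φ x) :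
    ∀ᵐ x ∂(volume.restrict (interior (simplex K))),
      ∑ z ∈ K, f z x = (P.c K - Λ * P.β₁ K) / (Λ + P.γ) * u x := by
  obtain ⟨pu, hpu⟩ := hu
  choose l hl using fun z => exists_affine_eq_hat hK z
  choose g hg using fun z => exists_gradient_eq_of_eqOn (hl z)
  obtain ⟨G, hG⟩ := exists_gradient_eq_of_eqOn hpu
  choose! q hq using hf
  set κ := (P.c K - Λ * P.β₁ K) / (Λ + P.γ) with hκ
  set U := interior (simplex K) with hU
  have hUm : MeasurableSet U := isOpen_interior.measurableSet
  have hUK : U ⊆ simplex K := interior_subset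
  -- The residual of the claimed identity is affine on `K` and is used as the test function for
  -- every vertex. After summation `∑ l z = 1` and `∑ s z = 0` leave `∫ r² = 0`.
  set r : Pt d →ᵃ[ℝ] ℝ := (∑ z ∈ K, q z) - κ • pu with hr
  have hrx : ∀ x, r x = ∑ z ∈ K, q z x - κ * pu x := by
    intro x
    rw [← affineMap_sum_apply]; rfl
  have hc := fun (q : Pt d →ᵃ[ℝ] ℝ) => continuous_affine q
  have hint : ∀ h : Pt d → ℝ, Continuous h → IntegrableOn h U := fun h hh =>
    memLp_one_iff_integrable.1 (memLp_of_continuous hh (isCompact_simplex K)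
      (isCompact_simplex K).measure_lt_top hUK 1)
  set s : Pt d → ℝ := fun z =>
    inner ℝ (Matrix.toEuclideanLin (P.A K) (g z)) G / (Λ + P.γ) with hs
  have hsum : ∑ z ∈ K, s z = 0 := by
    obtain ⟨x, hx⟩ := interior_simplex_nonempty hK
    have h0 := sum_gradient_hat hK hx fun z _ => hg z x hx
    rw [hs, ← Finset.sum_div, ← sum_inner, ← map_sum, h0, map_zero, inner_zero_left, zero_div]
  have hz : ∀ z ∈ K, ∫ x in U, (q z x - κ * (l z x * pu x) - s z) * r x = 0 := by
    intro z hzK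
    have hst : K ∈ P.mesh.star z := P.mesh.mem_star.2 ⟨hK, hzK⟩
    have h := heq z hzK _ (memQz_indicator hK z r)
    rw [setIntegral_patch_mul_indicator hst, setIntegral_patch_mul_indicator hst,
      setIntegral_patch_mul_indicator hst] at h
    have e1 : ∫ x in U, f z x * r x = ∫ x in U, q z x * r x := by
      refine integral_congr_ae ?_
      filter_upwards [ae_restrict_of_ae_restrict_of_subset hUK (hq z hzK)] with x hx
      rw [hx]
    have e2 : ∫ x in U, (P.cFun x - Λ * P.β₁Fun x) / (Λ + P.γ) * (P.mesh.hat z x * u x) * r x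
        = ∫ x in U, κ * (l z x * pu x) * r x := by
      refine setIntegral_congr_fun hUm fun x hx => ?_
      simp only [cFun, β₁Fun, piecewise_eq hK _ hx, hl z x (hUK hx), hpu x (hUK hx), hκ]
    have e3 : ∫ x in U,
        inner ℝ (P.applyA (gradient (P.mesh.hat z)) x) (gradient u x) / (Λ + P.γ) * r x
        = ∫ x in U, s z * r x := by
      refine setIntegral_congr_fun hUm fun x hx => ?_
      simp only [applyA, piecewise_eq hK _ hx, (hg z x hx).gradient, (hG x hx).gradient, hs]
    rw [e1, e2, e3] at h
    have i1 : IntegrableOn (fun x => q z x * r x) U := hint _ ((hc _).mul (hc r))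
    have i2 : IntegrableOn (fun x => κ * (l z x * pu x) * r x) U :=
      hint _ ((continuous_const.mul ((hc _).mul (hc _))).mul (hc r))
    have i3 : IntegrableOn (fun x => s z * r x) U := hint _ (continuous_const.mul (hc r))
    simp only [sub_mul]
    have i12 : IntegrableOn (fun x => q z x * r x - κ * (l z x * pu x) * r x) U := i1.sub i2
    rw [integral_sub i12 i3, integral_sub i1 i2, h]
    ring
  have hrr : ∫ x in U, r x * r x = 0 := by
    rw [← Finset.sum_eq_zero hz, ← integral_finsetSum]
    · refine setIntegral_congr_fun hUm fun x hx => ?_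
      have h1 : ∑ z ∈ K, l z x = 1 := by
        rw [← (exists_weights_eq_hat hK subset_rfl (hUK hx)).2.2.1]
        exact Finset.sum_congr rfl fun z _ => (hl z x (hUK hx)).symm
      rw [← Finset.sum_mul, Finset.sum_sub_distrib, Finset.sum_sub_distrib, hsum,
        ← Finset.mul_sum, ← Finset.sum_mul, h1, one_mul, sub_zero, ← hrx]
    · exact fun z _ => hint _ ((((hc _).sub (continuous_const.mul ((hc _).mul (hc _)))).sub
        continuous_const).mul (hc r))
  have hqa : ∀ᵐ x ∂(volume.restrict U), ∀ z ∈ K, f z x = q z x := by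
    rw [Filter.eventually_all_finset]
    exact fun z hz => ae_restrict_of_ae_restrict_of_subset hUK (hq z hz)
  filter_upwards [ae_eq_zero_of_integral_mul_self (hint _ ((hc r).mul (hc r))) hrr, hqa,
    ae_restrict_mem hUm] with x hx hxq hxU
  rw [hrx] at hx
  rw [Finset.sum_congr rfl hxq, hpu x (hUK hxU)]
  linarith

theorem ae_domain_of_ae_elements {M : SimplicialMesh d} {p : Pt d → Prop}
    (h : ∀ K ∈ M.elements, ∀ᵐ x ∂(volume.restrict (interior (simplex K))), p x) :
    ∀ᵐ x ∂(volume.restrict M.domain), p x := by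
  have h' : ∀ᵐ x ∂(volume : Measure (Pt d)), ∀ K ∈ M.elements, x ∈ interior (simplex K) → p x := by
    rw [Filter.eventually_all_finset]
    exact fun K hK => (ae_restrict_iff' isOpen_interior.measurableSet).1 (h K hK)
  filter_upwards [ae_domain (M := M), ae_restrict_of_ae h'] with x ⟨K, hK, hx⟩ hp
  exact hp K hK hx

/-- Green's formula for the sum of the local fluxes. -/
theorem integral_sumFlux_gradient (hd : 2 ≤ d) {Λ : ℝ} {u : Pt d → ℝ}
    (hu : ∀ K ∈ P.mesh.elements, ∃ p : Pt d →ᵃ[ℝ] ℝ, ∀ x ∈ simplex K, u x = p x)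
    {σ : Pt d → Pt d → Pt d} {f : Pt d → Pt d → ℝ}
    (hσ : ∀ z ∈ P.mesh.nodes, P.MemWz Λ u z (σ z) (f z)) {v : Pt d → ℝ} (hv : ContDiff ℝ ∞ v)
    (hv0 : ∀ E ∈ P.mesh.boundaryFacets P.Ω, E ∉ P.neumann → ∀ x ∈ simplex E, v x = 0) :
    (∫ x in P.Ω, inner ℝ (P.sumFlux σ x) (gradient v x))
        + ∫ x in P.Ω, P.mesh.extSum f x * v x
      = ∑ E ∈ P.neumannPlus,
          facetIntegral E (fun x => (Λ * P.β₂ E - P.α E) / (Λ + P.γ) * u x * v x) := by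
  classical
  have hgv := continuous_gradient hv
  have i1 : ∀ z ∈ P.mesh.nodes, IntegrableOn
      (fun x => inner ℝ (σ z x) (gradient v x)) (P.mesh.patch z) := fun z hz =>
    integrable_inner_of_memLp (hσ z hz).memHdiv.memLp (memLp_patch_of_continuous hgv 2 z)
  have i2 : ∀ z ∈ P.mesh.nodes, IntegrableOn (fun x => f z x * v x) (P.mesh.patch z) :=
    fun z hz => (hσ z hz).memHdiv.memLp_div.integrable_mul
      (memLp_patch_of_continuous hv.continuous 2 z)
  have e1 : ∀ x, inner ℝ (P.sumFlux σ x) (gradient v x)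
      = P.mesh.extSum (fun z y => inner ℝ (σ z y) (gradient v y)) x := by
    intro x
    change inner ℝ (P.mesh.extSum σ x) (gradient v x) = _
    simp only [extSum, sum_inner]
    exact Finset.sum_congr rfl fun z _ => by split_ifs <;> simp
  have e2 : ∀ x, P.mesh.extSum f x * v x = P.mesh.extSum (fun z y => f z y * v y) x := by
    intro x
    simp only [extSum, Finset.sum_mul]
    exact Finset.sum_congr rfl fun z _ => by split_ifs <;> simp
  simp only [e1, e2]
  rw [Ω, integral_extSum i1, integral_extSum i2, ← Finset.sum_add_distrib]
  choose! p hp htr using fun z hz => (hσ z hz).normalTrace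
  have hloc : ∀ z ∈ P.mesh.nodes,
      (∫ x in P.mesh.patch z, inner ℝ (σ z x) (gradient v x))
          + ∫ x in P.mesh.patch z, f z x * v x
        = ∑ E ∈ P.neumannPlus, if z ∈ E then
            facetIntegral E (fun x => (Λ * P.β₂ E - P.α E) / (Λ + P.γ) * p z E x * v x)
          else 0 := by
    intro z hz
    -- `v` is admissible in the formula on the patch: the facets of `∂ω_z` without prescribed flux
    -- lie on `Γ_D`, where `v` vanishes.
    rw [htr z hz v hv fun E hE hEz =>
      hv0 E (mem_boundaryFacets_of_notMem_prescribedFacets hE hEz).1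
        (mem_boundaryFacets_of_notMem_prescribedFacets hE hEz).2]
    have hsub : P.localNeumannPlus z ⊆ P.prescribedFacets z := by
      intro E hE
      simp [prescribedFacets, hE]
    have hfil : P.neumannPlus.filter (fun E => z ∈ E) = P.localNeumannPlus z := by
      ext E
      rw [Finset.mem_filter, mem_localNeumannPlus]
    rw [← Finset.sum_filter, hfil, ← Finset.sum_subset hsub]
    · exact Finset.sum_congr rfl fun E hE => by simp only [hE, if_true]
    · intro E _ hE
      simp [hE, facetIntegral]
  -- For a fixed facet only the patches of its own vertices contribute, and their projections add up
  -- to `u`.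
  rw [Finset.sum_congr rfl hloc, Finset.sum_comm]
  refine Finset.sum_congr rfl fun E hE => ?_
  have hEf : E ∈ P.mesh.facets :=
    (P.mesh.mem_boundaryFacets.1 (P.neumann_subset (neumannPlus_subset hE))).1
  have hEn : E ⊆ P.mesh.nodes := by
    obtain ⟨K, hK, hEK⟩ := exists_element_of_mem_facets hEf
    exact fun z hz => P.mesh.mem_nodes.2 ⟨K, hK, hEK hz⟩
  rw [← Finset.sum_filter, Finset.filter_mem_eq_inter, Finset.inter_eq_right.2 hEn]
  simp only [facetIntegral]
  rw [← integral_finsetSum]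
  · refine integral_congr_ae ?_
    filter_upwards [sum_facetProjection_ae_eq hd hEf hu (p := fun z => p z E)
      fun z hz => hp z (hEn hz) E (mem_localNeumannPlus.2 ⟨hE, hz⟩)] with x hx
    rw [← Finset.sum_mul, ← Finset.mul_sum, hx]
  · exact fun z _ => integrable_facet_of_continuous hd hEf
      ((continuous_const.mul (continuous_affine _)).mul hv.continuous)

/-! ### Global properties of the flux and the role of the thresholds. -/

theorem isRT1On_sumFlux {σ : Pt d → Pt d → Pt d} {K : Finset (Pt d)}
    (hK : K ∈ P.mesh.elements) (hσ : ∀ z ∈ K, IsRT1On K (σ z)) : IsRT1On K (P.sumFlux σ) := by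
  choose! a p hap using hσ
  refine ⟨∑ z ∈ K, a z, ∑ z ∈ K, p z, ?_⟩
  have hall : ∀ᵐ x ∂(volume.restrict (simplex K)), ∀ z ∈ K, σ z x = a z x + p z x • x := by
    rw [Filter.eventually_all_finset]
    exact hap
  filter_upwards [hall, ae_restrict_of_ae (simplex_ae_eq_interior K),
    ae_restrict_mem (measurableSet_simplex K)] with x hx hxe hxK
  change P.mesh.extSum σ x = _
  rw [extSum_eq_sum σ hK ((iff_of_eq hxe).2 hxK), Finset.sum_congr rfl hx,
    Finset.sum_add_distrib, ← Finset.sum_smul, affineMap_sum_apply, affineMap_sum_apply]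

theorem test_eq_zero_of_mem_boundaryFacets {φ : Pt d → ℝ} (hφ : IsTestFunction P.Ω φ)
    {E : Finset (Pt d)} (hE : E ∈ P.mesh.boundaryFacets P.Ω) {x : Pt d} (hx : x ∈ simplex E) :
    φ x = 0 := by
  have hfr := (P.mesh.mem_boundaryFacets.1 hE).2 hx
  rw [Ω, isOpen_domain.frontier_eq] at hfr
  exact image_eq_zero_of_notMem_tsupport fun h => hfr.2 (hφ.2.2 h)

/-- A test function with support in the open set `Ω` vanishes on `∂Ω`, so the global Green formula
loses its boundary term and becomes the definition of the weak divergence. -/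
theorem memHdiv_sumFlux (hd : 2 ≤ d) {Λ : ℝ} {u : Pt d → ℝ}
    (hu : ∀ K ∈ P.mesh.elements, ∃ p : Pt d →ᵃ[ℝ] ℝ, ∀ x ∈ simplex K, u x = p x)
    {σ : Pt d → Pt d → Pt d} {f : Pt d → Pt d → ℝ}
    (hσ : ∀ z ∈ P.mesh.nodes, P.MemWz Λ u z (σ z) (f z)) :
    MemHdiv P.Ω (P.sumFlux σ) (P.mesh.extSum f) where
  memLp := memLp_extSum (M := P.mesh) fun z hz => (hσ z hz).memHdiv.memLp
  memLp_div := memLp_extSum fun z hz => (hσ z hz).memHdiv.memLp_div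
  hasWeakDiv := by
    intro φ hφ
    have h := integral_sumFlux_gradient hd hu hσ hφ.1 fun E hE _ x hx =>
      test_eq_zero_of_mem_boundaryFacets hφ hE hx
    rw [Finset.sum_eq_zero] at h
    · linarith
    · intro E hE
      have hE' := P.neumann_subset (neumannPlus_subset hE)
      rw [facetIntegral, setIntegral_congr_fun (g := fun _ => (0 : ℝ)) (measurableSet_simplex E)]
      · simp
      · intro x hx
        simp [test_eq_zero_of_mem_boundaryFacets hφ hE' hx]

/-- Here `v` vanishes on `Γ_D` and also on `Γ_{N+}`, so the right-hand side of the global Green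
formula is zero. -/
theorem hasNormalTrace_neumannZero (hd : 2 ≤ d) {Λ : ℝ} {u : Pt d → ℝ}
    (hu : ∀ K ∈ P.mesh.elements, ∃ p : Pt d →ᵃ[ℝ] ℝ, ∀ x ∈ simplex K, u x = p x)
    {σ : Pt d → Pt d → Pt d} {f : Pt d → Pt d → ℝ}
    (hσ : ∀ z ∈ P.mesh.nodes, P.MemWz Λ u z (σ z) (f z)) :
    HasNormalTrace P.mesh P.Ω (P.sumFlux σ) (P.mesh.extSum f) P.neumannZero (fun _ _ => 0) := by
  classical
  intro v hv hv0
  rw [integral_sumFlux_gradient hd hu hσ hv, Finset.sum_eq_zero, Finset.sum_eq_zero]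
  · simp [facetIntegral]
  · intro E hE
    have hE0 : E ∉ P.neumannZero := by simp [neumannZero, hE]
    have hv0E := hv0 E (P.neumann_subset (neumannPlus_subset hE)) hE0
    rw [facetIntegral, setIntegral_congr_fun (g := fun _ => (0 : ℝ)) (measurableSet_simplex E)]
    · simp
    · intro x hx
      simp [hv0E x hx]
  · intro E hE hEN
    exact hv0 E hE (by simp [neumannZero, hEN])

theorem hasNormalTrace_neumannPlus (hd : 2 ≤ d) {Λ : ℝ} {u : Pt d → ℝ}
    (hu : ∀ K ∈ P.mesh.elements, ∃ p : Pt d →ᵃ[ℝ] ℝ, ∀ x ∈ simplex K, u x = p x)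
    {σ : Pt d → Pt d → Pt d} {f : Pt d → Pt d → ℝ}
    (hσ : ∀ z ∈ P.mesh.nodes, P.MemWz Λ u z (σ z) (f z)) :
    HasNormalTrace P.mesh P.Ω (P.sumFlux σ) (P.mesh.extSum f) P.neumannPlus
      (fun E x => (Λ * P.β₂ E - P.α E) / (Λ + P.γ) * u x) := fun _ hv hv0 =>
  integral_sumFlux_gradient hd hu hσ hv fun E hE hEN =>
    hv0 E hE fun h => hEN (neumannPlus_subset h)

theorem measurable_piecewise (M : SimplicialMesh d) (a : Finset (Pt d) → ℝ) :
    Measurable (M.piecewise a) := by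
  classical
  unfold SimplicialMesh.piecewise
  exact Finset.measurable_fun_sum _ fun K _ =>
    Measurable.ite isOpen_interior.measurableSet measurable_const measurable_const

variable (P) in
theorem measurableSet_ΩZero : MeasurableSet P.ΩZero := by
  have hΩ : MeasurableSet P.Ω := isOpen_domain.measurableSet
  exact hΩ.diff (hΩ.inter
    ((measurableSet_le measurable_const (measurable_piecewise P.mesh P.c)).union
      (measurableSet_le measurable_const (measurable_piecewise P.mesh P.β₁))))

/-- Off `Γ_{N+}` the value lies below a threshold that no positive value undercuts. -/
theorem β₂_eq_zero_of_mem_neumannZero {E : Finset (Pt d)} (hE : E ∈ P.neumannZero) :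
    P.β₂ E = 0 := by
  classical
  simp only [neumannZero, neumannPlus, Finset.mem_sdiff, Finset.mem_filter, not_and, not_or,
    not_le] at hE
  refine le_antisymm (not_lt.1 fun h => ?_) (P.β₂_nonneg E hE.1)
  exact (hE.2 hE.1).2.not_ge (P.β₂₀_le E hE.1 h)

theorem coeff_eq_zero_of_mem_ΩZero {K : Finset (Pt d)} (hK : K ∈ P.mesh.elements) {x : Pt d}
    (hx : x ∈ P.ΩZero) (hxK : x ∈ interior (simplex K)) : P.c K = 0 ∧ P.β₁ K = 0 := by
  have h : ¬ (P.c₀ ≤ P.c K ∨ P.β₁₀ ≤ P.β₁ K) := by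
    have := hx.2
    simp only [ΩPlus, Set.mem_ofPred_eq, not_and, cFun, β₁Fun, piecewise_eq hK _ hxK] at this
    exact this hx.1
  rw [not_or] at h
  exact ⟨le_antisymm (not_lt.1 fun hc => h.1 (P.c₀_le K hK hc)) (P.c_nonneg K hK),
    le_antisymm (not_lt.1 fun hc => h.2 (P.β₁₀_le K hK hc)) (P.β₁_nonneg K hK)⟩

theorem div_sumFlux_ae_eq {Λ : ℝ} {u : Pt d → ℝ}
    (hu : ∀ K ∈ P.mesh.elements, ∃ p : Pt d →ᵃ[ℝ] ℝ, ∀ x ∈ simplex K, u x = p x)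
    {σ : Pt d → Pt d → Pt d} {f : Pt d → Pt d → ℝ}
    (hσ : ∀ z ∈ P.mesh.nodes, P.MemWz Λ u z (σ z) (f z))
    (heq : ∀ z ∈ P.mesh.nodes, ∀ φ : Pt d → ℝ, P.MemQz z φ →
      ∫ x in P.mesh.patch z, f z x * φ x
        = (∫ x in P.mesh.patch z,
            (P.cFun x - Λ * P.β₁Fun x) / (Λ + P.γ) * (P.mesh.hat z x * u x) * φ x) +
          ∫ x in P.mesh.patch z,
            inner ℝ (P.applyA (gradient (P.mesh.hat z)) x) (gradient u x) / (Λ + P.γ) * φ x) :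
    ∀ᵐ x ∂(volume.restrict P.Ω),
      P.mesh.extSum f x = (P.cFun x - Λ * P.β₁Fun x) / (Λ + P.γ) * u x := by
  refine ae_domain_of_ae_elements fun K hK => ?_
  have hn : ∀ z ∈ K, z ∈ P.mesh.nodes := fun z hz => P.mesh.mem_nodes.2 ⟨K, hK, hz⟩
  have hst : ∀ z ∈ K, K ∈ P.mesh.star z := fun z hz => P.mesh.mem_star.2 ⟨hK, hz⟩
  filter_upwards [sum_div_ae_eq hK (hu K hK)
    (fun z hz => ((hσ z (hn z hz)).isRT1 K (hst z hz)).isP1On_div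
      (interior_simplex_subset_patch (hst z hz)) (hσ z (hn z hz)).memHdiv)
    (fun z hz => heq z (hn z hz)), ae_restrict_mem isOpen_interior.measurableSet] with x hx hxK
  rw [extSum_eq_sum f hK hxK, hx]
  simp only [cFun, β₁Fun, piecewise_eq hK _ hxK]

end EigenProblem

end FluxLocalization

theorem mainTheorem2 {d : ℕ} (hd : 2 ≤ d) (P : FluxLocalization.EigenProblem d)
    (Λ : ℝ) (u : FluxLocalization.Pt d → ℝ) (hu : P.IsDiscreteEigenpair Λ u)
    (σ : FluxLocalization.Pt d → FluxLocalization.Pt d → FluxLocalization.Pt d)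
    (q : FluxLocalization.Pt d → FluxLocalization.Pt d → ℝ)
    (hσ : ∀ z ∈ P.mesh.nodes, P.IsLocalSolution Λ u z (σ z) (q z)) :
    P.MemWTilde (P.sumFlux σ) ∧
      P.SatisfiesConstraints Λ u (P.sumFlux σ) ∧
      P.LehmannGoerischAdmissible u (P.sumFlux σ) := by
  choose! f hW _ _ heq using hσ
  have hP1 := hu.memVh.2
  have hdiv := FluxLocalization.EigenProblem.memHdiv_sumFlux hd hP1 hW
  have hae := FluxLocalization.EigenProblem.div_sumFlux_ae_eq hP1 hW heq
  have hN0 := FluxLocalization.EigenProblem.hasNormalTrace_neumannZero hd hP1 hW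
  refine ⟨⟨P.mesh.extSum f, hdiv, fun K hK => ?_, hN0⟩,
    ⟨P.mesh.extSum f, hdiv, hae,
      FluxLocalization.EigenProblem.hasNormalTrace_neumannPlus hd hP1 hW⟩,
    hu.memVh.1, P.mesh.extSum f, hdiv, ?_, ?_⟩
  · exact FluxLocalization.EigenProblem.isRT1On_sumFlux hK fun z hz =>
      (hW z (P.mesh.mem_nodes.2 ⟨K, hK, hz⟩)).isRT1 K (P.mesh.mem_star.2 ⟨hK, hz⟩)
  · have hsub : P.ΩZero ⊆ P.Ω := Set.sdiff_subset
    filter_upwards [ae_restrict_of_ae_restrict_of_subset hsub hae,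
      ae_restrict_of_ae_restrict_of_subset hsub
        (FluxLocalization.SimplicialMesh.ae_domain (M := P.mesh)),
      ae_restrict_mem P.measurableSet_ΩZero] with x hx ⟨K, hK, hxK⟩ hx0
    -- On `Ω₀` both `c` and `β₁` vanish, so `β₁ u` and the divergence of the flux are separately
    -- zero.
    obtain ⟨hc, hβ⟩ := FluxLocalization.EigenProblem.coeff_eq_zero_of_mem_ΩZero hK hx0 hxK
    rw [hx]
    simp [FluxLocalization.EigenProblem.cFun, FluxLocalization.EigenProblem.β₁Fun,
      FluxLocalization.SimplicialMesh.piecewise_eq hK _ hxK, hc, hβ]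
  · intro v hv hv0
    rw [hN0 v hv hv0]
    refine Finset.sum_congr rfl fun E hE => ?_
    -- Since `β₂ = 0` on `Γ_{N0}`, the required trace `β₂ u` is the zero trace already established.
    simp only [FluxLocalization.EigenProblem.β₂_eq_zero_of_mem_neumannZero hE, zero_mul]
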